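/- Let $G$ be an arbitrary group and let $K$ be a field. Let $\mathrm{Soc}(G)$ be the subgroup of $G$ generated by all minimal normal subgroups of $G$, and let $\mathrm{T}(G)$ be the subgroup generated by all minimal normal subgroups of $G$ that are torsion abelian; the group $\mathrm{T}(G)$ is abelian. For a prime $p$ let $\mathrm{T}(G)_p$ be the subgroup of elements of $p$-power order in $\mathrm{T}(G)$, and let $\Pi(G)$ be the set of primes $p$ with $\mathrm{T}(G)_p$ non-trivial. Assume that: (1) $\mathrm{Soc}(G)$ is essential, that is, every non-trivial normal subgroup of $G$ intersects $\mathrm{Soc}(G)$ non-trivially; (2) if $K$ has prime characteristic $p$ and $M$ is a minimal normal subgroup of $G$ which is a non-abelian $p$-group that is not finitely generated, then $M$ admits a non-trivial irreducible representation over $K$ (an irreducible $K$-representation on which some element of $M$ does not act as the identity; dimensions may be infinite); (3) $\mathrm{char}(K)\notin\Pi(G)$; (4) $\mathrm{T}(G)$ has a subgroup $S$ such that $\mathrm{T}(G)/S$ is locally cyclic (all its finitely generated subgroups are cyclic) and $\bigcap_{g\in G} gSg^{-1}=1$. Then $G$ has a faithful irreducible representation over $K$ (possibly of infinite dimension). 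-/

import Mathlib

namespace FaithfulIrr

/-- A minimal normal subgroup of `G`: minimal among the non-trivial normal subgroups. -/
def IsMinimalNormal {G : Type*} [Group G] (N : Subgroup G) : Prop :=
  Minimal (fun L : Subgroup G => L.Normal ∧ L ≠ ⊥) N

/-- `Soc(G)`, the subgroup generated by all minimal normal subgroups of `G`. -/
def socle (G : Type*) [Group G] : Subgroup G :=
  sSup {N : Subgroup G | IsMinimalNormal N}

/-- `T(G)`, the subgroup generated by all minimal normal subgroups of `G` that are
torsion abelian. -/
def torsionSocle (G : Type*) [Group G] : Subgroup G :=
  sSup {N : Subgroup G | IsMinimalNormal N ∧ IsMulCommutative N ∧ IsMulTorsion N}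

/-- A normal subgroup `N` of `G` is essential if every non-trivial normal subgroup of `G`
intersects it non-trivially. -/
def IsEssential {G : Type*} [Group G] (N : Subgroup G) : Prop :=
  N.Normal ∧ ∀ L : Subgroup G, L.Normal → L ≠ ⊥ → L ⊓ N ≠ ⊥

/-- A group is locally cyclic if all its finitely generated subgroups are cyclic. -/
def IsLocallyCyclic (H : Type*) [Group H] : Prop :=
  ∀ L : Subgroup H, L.FG → IsCyclic L

/-- Distinct minimal normal subgroups commute elementwise, so elements of abelian minimal
normal subgroups commute. -/
theorem IsMinimalNormal.commute {G : Type*} [Group G] {M N : Subgroup G}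
    (hM : IsMinimalNormal M) (hN : IsMinimalNormal N) (hc : IsMulCommutative M)
    {x y : G} (hx : x ∈ M) (hy : y ∈ N) : x * y = y * x := by
  have hMn : M.Normal := hM.prop.1
  have hNn : N.Normal := hN.prop.1
  by_cases h : M ⊓ N = ⊥
  · exact Subgroup.commute_of_normal_of_disjoint M N hMn hNn (disjoint_iff.mpr h) x y hx hy
  · have hn : (M ⊓ N).Normal := inferInstance
    have h2 : N ≤ M ⊓ N := hN.2 ⟨hn, h⟩ inf_le_right
    have hyM : y ∈ M := (h2 hy).1
    exact congrArg Subtype.val (hc.is_comm.comm (⟨x, hx⟩ : M) ⟨y, hyM⟩)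

/-- `T(G)` is abelian. -/
theorem torsionSocle_comm {G : Type*} [Group G] {x y : G} (hx : x ∈ torsionSocle G)
    (hy : y ∈ torsionSocle G) : x * y = y * x := by
  have key : torsionSocle G ≤ Subgroup.centralizer (torsionSocle G : Set G) := by
    refine sSup_le fun M hM a ha => ?_
    have h : torsionSocle G ≤ Subgroup.centralizer {a} := by
      refine sSup_le fun N hN b hb => ?_
      rw [Subgroup.mem_centralizer_singleton_iff]
      exact (hM.1.commute hN.1 hM.2.1 ha hb).symm
    rw [Subgroup.mem_centralizer_iff]
    intro b hb
    exact Subgroup.mem_centralizer_singleton_iff.mp (h hb)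
  exact (Subgroup.mem_centralizer_iff.mp (key hx) y hy).symm

/-- Since `T(G)` is abelian, each of its subgroups is normal in it, so that quotients of `T(G)`
are groups. -/
instance subgroupOf_torsionSocle_normal {G : Type*} [Group G] (S : Subgroup G) :
    (S.subgroupOf (torsionSocle G)).Normal where
  conj_mem n hn g := by
    have h : g * n = n * g := Subtype.ext (torsionSocle_comm g.2 n.2)
    rwa [h, mul_inv_cancel_right]

/-- `T(G)_p`, the `p`-part of `T(G)`: its elements of `p`-power order. -/
def torsionSoclePart (G : Type*) [Group G] (p : ℕ) : Subgroup G where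
  carrier := {x | x ∈ torsionSocle G ∧ ∃ k : ℕ, x ^ p ^ k = 1}
  one_mem' := ⟨one_mem _, 0, one_pow _⟩
  mul_mem' := by
    rintro x y ⟨hx, k, hk⟩ ⟨hy, l, hl⟩
    refine ⟨mul_mem hx hy, k + l, ?_⟩
    have hxy : Commute x y := torsionSocle_comm hx hy
    rw [hxy.mul_pow, pow_add, pow_mul, hk, one_pow, mul_comm, pow_mul, hl, one_pow, one_mul]
  inv_mem' := by
    rintro x ⟨hx, k, hk⟩
    exact ⟨inv_mem hx, k, by rw [inv_pow, hk, inv_one]⟩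

/-- `Π(G)`, the set of primes `p` such that `T(G)_p` is non-trivial. -/
def socPrimes (G : Type*) [Group G] : Set ℕ :=
  {p | p.Prime ∧ torsionSoclePart G p ≠ ⊥}

universe u v

/-- `G` has a non-trivial irreducible representation over `K`, that is, one that is not the
trivial representation. An irreducible representation of `G` over `K` is isomorphic to a quotient
of the group algebra, so the universe of `V` loses nothing. -/
def HasNontrivialIrreducibleRep (K : Type v) (G : Type u) [Field K] [Group G] : Prop :=
  ∃ (V : Type (max u v)) (_ : AddCommGroup V) (_ : Module K V) (ρ : Representation K G V),
    ρ.IsIrreducible ∧ ∃ g : G, ρ g ≠ 1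

/-- `G` has a faithful irreducible representation over `K`. -/
def HasFaithfulIrreducibleRep (K : Type v) (G : Type u) [Field K] [Group G] : Prop :=
  ∃ (V : Type (max u v)) (_ : AddCommGroup V) (_ : Module K V) (ρ : Representation K G V),
    ρ.IsIrreducible ∧ Function.Injective ρ

end FaithfulIrr

/-! The aim is a proper left ideal `J` of `K[G]` with `J ⊔ augIdeal K N = ⊤` for every minimal
normal subgroup `N`. If `I` is a maximal left ideal above `J`, then `K[G] ⧸ I` is simple. If `N`
acted trivially on it, all `n - 1` would lie in `I`, forcing `I = ⊤`. A non-trivial kernel would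
contain a minimal normal subgroup, because the socle is essential, so the representation is
faithful.

The ideal `J` is glued from proper left ideals of group algebras of subgroups that commute and are
independent: the torsion-free abelian part of the socle, `torsionSocle G`, and each non-abelian
minimal normal subgroup. Properness survives both extension to `K[G]` and gluing, since a left ideal
is proper when a linear functional kills it but not `1`, and functionals can be extended by zero and
multiplied (`span_map_subtype_ne_top`, `span_union_ne_top`, `span_union_iUnion_ne_top`).

The main local tool is the sum `1 + x + ⋯ + x ^ (q - 1)` with `x ∈ N`: modulo `augIdeal K N` it is
the scalar `q`, a unit when `q ≠ char K`. On the torsion part such sums are pulled back from the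
locally cyclic quotient by `S`; no minimal normal `N` lies in `S`, because `S` has trivial core.

On the torsion-free part the minimal normal subgroups are divisible. In countable rank the group
embeds in `ℚ_[q]`, and residues of `q`-adic integers supply the sums. In infinite rank it embeds in
the units of a field so that some power of `ψ (x ^ a) - 1` is again in the image of the group.

A non-abelian `N` either has an element of infinite order or of order divisible by a prime other
than `char K`, or is a `p`-group with `p = char K`. In the latter case, if `N` is finitely generated
then perfectness gives a non-trivial simple module; otherwise one is assumed. -/

namespace FaithfulIrr

open MonoidAlgebra
open scoped commutatorElement

/-! ### Gluing proper left ideals by linear functionals -/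

section Functional

variable {K H : Type*} [Field K] [Group H]

/-- The linear functional on the group algebra that extends a function on the group. -/
noncomputable def functionalOf (f : H → K) : MonoidAlgebra K H →ₗ[K] K :=
  (Finsupp.linearCombination K f) ∘ₗ (coeffLinearEquiv K).toLinearMap

theorem functionalOf_of (f : H → K) (h : H) : functionalOf f (of K H h) = f h := by
  simp [functionalOf, coeffLinearEquiv]

theorem exists_functional {J : Ideal (MonoidAlgebra K H)} (hJ : J ≠ ⊤) :
    ∃ l : MonoidAlgebra K H →ₗ[K] K, l 1 = 1 ∧ ∀ a ∈ J, l a = 0 := by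
  have h1 : (1 : MonoidAlgebra K H) ∉ J.restrictScalars K := fun h => hJ ((Ideal.eq_top_iff_one J).2 h)
  obtain ⟨l, hl, hJl⟩ := Submodule.exists_le_ker_of_notMem h1
  refine ⟨(l 1)⁻¹ • l, by simp [hl], fun a ha => ?_⟩
  have : l a = 0 := hJl ha
  simp [this]

/-- The left ideal is spanned over `K` by the products `h * x`, so a functional vanishing on these
vanishes on the whole ideal and separates it from `1`. -/
theorem span_ne_top_of_functional {X : Set (MonoidAlgebra K H)} (l : MonoidAlgebra K H →ₗ[K] K)
    (h1 : l 1 ≠ 0) (hX : ∀ x ∈ X, ∀ h : H, l (of K H h * x) = 0) : Ideal.span X ≠ ⊤ := by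
  have key : ∀ a ∈ Ideal.span X, ∀ b : MonoidAlgebra K H, l (b * a) = 0 := by
    intro a ha
    induction ha using Submodule.span_induction with
    | mem x hx =>
      intro b
      induction b using MonoidAlgebra.induction_on with
      | of g => exact hX x hx g
      | add f g hf hg => rw [add_mul, map_add, hf, hg, add_zero]
      | smul r f hf => rw [smul_mul_assoc, map_smul, hf, smul_zero]
    | zero => simp
    | add x y _ _ hx hy => intro b; rw [mul_add, map_add, hx, hy, add_zero]
    | smul r x _ hx => intro b; rw [smul_eq_mul, ← mul_assoc]; exact hx _
  intro h
  exact h1 (by simpa using key 1 (h ▸ Submodule.mem_top) 1)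

theorem eq_of_mem_supported {C : Set H} {l m : MonoidAlgebra K H →ₗ[K] K}
    (h : ∀ c ∈ C, l (of K H c) = m (of K H c)) {a : MonoidAlgebra K H} (ha : a ∈ supported K K C) :
    l a = m a := by
  rw [supported_eq_span_single] at ha
  refine LinearMap.eqOn_span (f := l) (g := m) ?_ ha
  rintro _ ⟨c, hc, rfl⟩
  exact h c hc

/-- A proper left ideal of the group algebra of a subgroup generates a proper left ideal. -/
theorem span_map_subtype_ne_top {C : Subgroup H} {J : Ideal (MonoidAlgebra K C)} (hJ : J ≠ ⊤) :
    Ideal.span (mapDomainRingHom K C.subtype '' (J : Set (MonoidAlgebra K C))) ≠ ⊤ := by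
  classical
  obtain ⟨l, h1, hl⟩ := exists_functional hJ
  -- Extension by zero works because left multiplication by `h` carries `C` to the coset `hC`, which
  -- is `C` itself or disjoint from it.
  let f : H → K := fun h => if hh : h ∈ C then l (of K C ⟨h, hh⟩) else 0
  refine span_ne_top_of_functional (functionalOf f) ?_ ?_
  · rw [one_def, ← of_apply, functionalOf_of]
    have : l (of K C ⟨1, one_mem C⟩) = 1 := by rw [← h1]; rfl
    simp only [f, one_mem, dif_pos, this]
    exact one_ne_zero
  · rintro _ ⟨j, hj, rfl⟩ h
    by_cases hh : h ∈ C
    · have : ∀ a : MonoidAlgebra K C,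
          functionalOf f (of K H h * mapDomainRingHom K C.subtype a) = l (of K C ⟨h, hh⟩ * a) := by
        intro a
        induction a using MonoidAlgebra.induction_on with
        | of g =>
          have e : mapDomainRingHom K C.subtype (of K C g) = of K H g := by simp
          rw [e, ← map_mul, ← map_mul, functionalOf_of]
          simp [f, mul_mem hh g.2]
          rfl
        | add a b ha hb => rw [map_add, mul_add, map_add, mul_add, map_add, ha, hb]
        | smul r a ha =>
          have e : mapDomainRingHom K C.subtype (r • a) = r • mapDomainRingHom K C.subtype a :=
            mapDomain_smul _ _ _
          rw [e, mul_smul_comm, map_smul, mul_smul_comm, map_smul, ha]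
      rw [this]
      exact hl _ (J.mul_mem_left _ hj)
    · generalize j = a
      induction a using MonoidAlgebra.induction_on with
      | of g =>
        have e : mapDomainRingHom K C.subtype (of K C g) = of K H g := by simp
        rw [e, ← map_mul, functionalOf_of]
        have : h * g ∉ C := fun h' => hh ((mul_mem_cancel_right g.2).1 h')
        simp [f, this]
      | add a b ha hb => rw [map_add, mul_add, map_add, ha, hb, add_zero]
      | smul r a ha =>
        have e : mapDomainRingHom K C.subtype (r • a) = r • mapDomainRingHom K C.subtype a :=
          mapDomain_smul _ _ _
        rw [e, mul_smul_comm, map_smul, ha, smul_zero]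

theorem mapDomain_subtype_mem_supported {C : Subgroup H} (a : MonoidAlgebra K C) :
    mapDomainRingHom K C.subtype a ∈ supported K K (C : Set H) := by
  induction a using MonoidAlgebra.induction_on with
  | of g =>
    rw [supported_eq_span_single]
    refine Submodule.subset_span ⟨g, g.2, by simp⟩
  | add a b ha hb => rw [map_add]; exact add_mem ha hb
  | smul r a ha =>
    have e : mapDomainRingHom K C.subtype (r • a) = r • mapDomainRingHom K C.subtype a :=
      mapDomain_smul _ _ _
    rw [e]; exact Submodule.smul_mem _ _ ha

/-- Proper left ideals generated by elements supported on commuting independent subgroups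
generate together a proper left ideal. -/
theorem span_union_ne_top {C D : Subgroup H} (hcomm : ∀ c ∈ C, ∀ d ∈ D, c * d = d * c)
    (hdisj : Disjoint C D) {X Y : Set (MonoidAlgebra K H)}
    (hXC : X ⊆ supported K K (C : Set H)) (hYD : Y ⊆ supported K K (D : Set H))
    (hX : Ideal.span X ≠ ⊤) (hY : Ideal.span Y ≠ ⊤) : Ideal.span (X ∪ Y) ≠ ⊤ := by
  classical
  obtain ⟨l, l1, hl⟩ := exists_functional hX
  obtain ⟨m, m1, hm⟩ := exists_functional hY
  let P : H → Prop := fun h => ∃ c d : H, c ∈ C ∧ d ∈ D ∧ h = c * d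
  -- This is the product functional `l ⊗ m` on `K[CD] = K[C] ⊗ K[D]`, extended by zero; disjointness
  -- makes the factorization `c * d` unique, so the choice is harmless.
  let f : H → K := fun h => if hh : P h then
    l (of K H hh.choose) * m (of K H hh.choose_spec.choose) else 0
  have f_mul : ∀ c ∈ C, ∀ d ∈ D, f (c * d) = l (of K H c) * m (of K H d) := by
    intro c hc d hd
    have hP : P (c * d) := ⟨c, d, hc, hd, rfl⟩
    obtain ⟨h1, h2, h3⟩ := hP.choose_spec.choose_spec
    have := Subgroup.mul_injective_of_disjoint hdisj
      (a₁ := (⟨c, hc⟩, ⟨d, hd⟩)) (a₂ := (⟨_, h1⟩, ⟨_, h2⟩)) h3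
    simp only [Prod.mk.injEq, Subtype.mk.injEq] at this
    simp only [f, dif_pos hP]
    exact congrArg₂ (fun a b => l (of K H a) * m (of K H b)) this.1.symm this.2.symm
  have f_zero : ∀ h, ¬ P h → f h = 0 := fun h hh => by simp [f, hh]
  have of1 : (of K H 1 : MonoidAlgebra K H) = 1 := map_one _
  refine span_ne_top_of_functional (functionalOf f) ?_ ?_
  · have := f_mul 1 (one_mem _) 1 (one_mem _)
    rw [mul_one, of1, l1, m1, mul_one] at this
    rw [← of1, functionalOf_of, this]
    exact one_ne_zero
  · rintro x (hx | hx) h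
    · by_cases hh : P h
      · obtain ⟨c, d, hc, hd, rfl⟩ := hh
        have := eq_of_mem_supported (C := (C : Set H))
          (l := functionalOf f ∘ₗ LinearMap.mulLeft K (of K H (c * d)))
          (m := m (of K H d) • (l ∘ₗ LinearMap.mulLeft K (of K H c))) ?_ (hXC hx)
        · simp only [LinearMap.comp_apply, LinearMap.mulLeft_apply, LinearMap.smul_apply] at this
          rw [this, hl _ (Ideal.mul_mem_left _ _ (Ideal.subset_span hx)), smul_zero]
        · intro g hg
          simp only [LinearMap.comp_apply, LinearMap.mulLeft_apply, LinearMap.smul_apply]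
          -- Moving `d` past the support of `x` leaves `m d * l (c * x)`, and `l` kills the left
          -- multiple `c * x`.
          rw [← map_mul, ← map_mul, functionalOf_of, mul_assoc, ← hcomm g hg d hd, ← mul_assoc,
            f_mul _ (mul_mem hc hg) _ hd, smul_eq_mul, mul_comm]
      · have := eq_of_mem_supported (C := (C : Set H))
          (l := functionalOf f ∘ₗ LinearMap.mulLeft K (of K H h)) (m := 0) ?_ (hXC hx)
        · simpa using! this
        · intro g hg
          simp only [LinearMap.comp_apply, LinearMap.mulLeft_apply, LinearMap.zero_apply]
          rw [← map_mul, functionalOf_of]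
          refine f_zero _ ?_
          rintro ⟨c, d, hc, hd, e⟩
          refine hh ⟨c * g⁻¹, d, mul_mem hc (inv_mem hg), hd, ?_⟩
          rw [mul_assoc, hcomm _ (inv_mem hg) d hd, ← mul_assoc, ← e, mul_inv_cancel_right]
    · by_cases hh : P h
      · obtain ⟨c, d, hc, hd, rfl⟩ := hh
        have := eq_of_mem_supported (C := (D : Set H))
          (l := functionalOf f ∘ₗ LinearMap.mulLeft K (of K H (c * d)))
          (m := l (of K H c) • (m ∘ₗ LinearMap.mulLeft K (of K H d))) ?_ (hYD hx)
        · simp only [LinearMap.comp_apply, LinearMap.mulLeft_apply, LinearMap.smul_apply] at this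
          rw [this, hm _ (Ideal.mul_mem_left _ _ (Ideal.subset_span hx)), smul_zero]
        · intro g hg
          simp only [LinearMap.comp_apply, LinearMap.mulLeft_apply, LinearMap.smul_apply]
          rw [← map_mul, ← map_mul, functionalOf_of, mul_assoc,
            f_mul _ hc _ (mul_mem hd hg), smul_eq_mul]
      · have := eq_of_mem_supported (C := (D : Set H))
          (l := functionalOf f ∘ₗ LinearMap.mulLeft K (of K H h)) (m := 0) ?_ (hYD hx)
        · simpa using! this
        · intro g hg
          simp only [LinearMap.comp_apply, LinearMap.mulLeft_apply, LinearMap.zero_apply]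
          rw [← map_mul, functionalOf_of]
          refine f_zero _ ?_
          rintro ⟨c, d, hc, hd, e⟩
          refine hh ⟨c, d * g⁻¹, hc, mul_mem hd (inv_mem hg), ?_⟩
          rw [← mul_assoc, ← e, mul_inv_cancel_right]

/-- The version of `span_union_ne_top` for arbitrary families. -/
theorem span_union_iUnion_ne_top {ι : Type*} {D : Subgroup H} {C : ι → Subgroup H}
    (hcomm : ∀ i, ∀ s : Finset ι, i ∉ s → ∀ c ∈ D ⊔ ⨆ j ∈ s, C j, ∀ d ∈ C i, c * d = d * c)
    (hdisj : ∀ i, ∀ s : Finset ι, i ∉ s → Disjoint (D ⊔ ⨆ j ∈ s, C j) (C i))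
    {Y : Set (MonoidAlgebra K H)} {X : ι → Set (MonoidAlgebra K H)}
    (hYD : Y ⊆ supported K K (D : Set H)) (hXC : ∀ i, X i ⊆ supported K K (C i : Set H))
    (hY : Ideal.span Y ≠ ⊤) (hX : ∀ i, Ideal.span (X i) ≠ ⊤) :
    Ideal.span (Y ∪ ⋃ i, X i) ≠ ⊤ := by
  classical
  have fin : ∀ s : Finset ι, Ideal.span (Y ∪ ⋃ i ∈ s, X i) ≠ ⊤ := by
    intro s
    induction s using Finset.induction_on with
    | empty => simpa using hY
    | insert i s hi ih =>
      have hu : Y ∪ ⋃ j ∈ insert i s, X j = (Y ∪ ⋃ j ∈ s, X j) ∪ X i := by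
        rw [Finset.set_biUnion_insert, Set.union_comm (X i), Set.union_assoc]
      rw [hu]
      refine span_union_ne_top (hcomm i s hi) (hdisj i s hi) ?_ (hXC i) ih (hX i)
      refine Set.union_subset (hYD.trans (supported_mono (SetLike.coe_subset_coe.2 le_sup_left))) ?_
      refine Set.iUnion₂_subset fun j hj => (hXC j).trans (supported_mono ?_)
      exact SetLike.coe_subset_coe.2 (le_sup_of_le_right (le_iSup₂_of_le j hj le_rfl))
  -- An equation expressing `1` involves only finitely many generators, so it already holds in a
  -- finite subfamily.
  intro h
  have h1 : (1 : MonoidAlgebra K H) ∈ Ideal.span (Y ∪ ⋃ i, X i) := h ▸ Submodule.mem_top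
  obtain ⟨t, ht, h1t⟩ := Submodule.mem_span_finite_of_mem_span h1
  have : ∃ s : Finset ι, (t : Set (MonoidAlgebra K H)) ⊆ Y ∪ ⋃ i ∈ s, X i := by
    clear h1t
    induction t using Finset.induction_on with
    | empty => exact ⟨∅, by simp⟩
    | insert a t _ ih =>
      rw [Finset.coe_insert, Set.insert_subset_iff] at ht
      obtain ⟨s, hs⟩ := ih ht.2
      rcases ht.1 with ha | ha
      · exact ⟨s, by rw [Finset.coe_insert, Set.insert_subset_iff]; exact ⟨Or.inl ha, hs⟩⟩
      · obtain ⟨i, hi⟩ := Set.mem_iUnion.1 ha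
        refine ⟨insert i s, ?_⟩
        rw [Finset.coe_insert, Set.insert_subset_iff, Finset.set_biUnion_insert]
        exact ⟨Or.inr (Or.inl hi), hs.trans (Set.union_subset_union_right _ Set.subset_union_right)⟩
  obtain ⟨s, hs⟩ := this
  exact fin s ((Ideal.eq_top_iff_one _).2 (Submodule.span_mono hs h1t))

end Functional

/-! ### Augmentation ideals and proper left ideals complementing them -/

section Augmentation

variable {K H : Type*} [Field K] [Group H]

variable (K) in
/-- The left ideal of the group algebra generated by the elements `n - 1` with `n ∈ N`. -/
noncomputable def augIdeal (N : Subgroup H) : Ideal (MonoidAlgebra K H) :=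
  Ideal.span ((fun n => of K H n - 1) '' (N : Set H))

theorem of_sub_one_mem_augIdeal {N : Subgroup H} {n : H} (hn : n ∈ N) :
    of K H n - 1 ∈ augIdeal K N :=
  Ideal.subset_span ⟨n, hn, rfl⟩

variable (K) in
/-- The element `1 + x + ⋯ + x ^ (q - 1)` of the group algebra. -/
noncomputable def geomSum (q : ℕ) (x : H) : MonoidAlgebra K H :=
  ∑ j ∈ Finset.range q, of K H x ^ j

theorem map_geomSum {H' : Type*} [Group H'] (f : H →* H') (q : ℕ) (x : H) :
    mapDomainRingHom K f (geomSum K q x) = geomSum K q (f x) := by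
  simp [geomSum]

theorem geomSum_mul_sub_one {q : ℕ} {x : H} (hx : x ^ q = 1) :
    geomSum K q x * (of K H x - 1) = 0 := by
  rw [geomSum, geom_sum_mul, ← map_pow, hx, map_one, sub_self]

theorem geomSum_mem_supported {N : Subgroup H} {x : H} (hx : x ∈ N) (q : ℕ) :
    geomSum K q x ∈ supported K K (N : Set H) := by
  refine Submodule.sum_mem _ fun j _ => ?_
  rw [← map_pow, supported_eq_span_single]
  exact Submodule.subset_span ⟨x ^ j, pow_mem hx j, by simp⟩

/-- Each power of `x` is congruent to `1` modulo `augIdeal K N`, so the sum is congruent to the unit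
`q`. Nothing is required of the order of `x`. -/
theorem sup_augIdeal_eq_top_of_geomSum_mem {I : Ideal (MonoidAlgebra K H)} {N : Subgroup H} {q : ℕ}
    (hq : (q : K) ≠ 0) {x : H} (hx : x ∈ N) (hI : geomSum K q x ∈ I) : I ⊔ augIdeal K N = ⊤ := by
  have h : geomSum K q x - (q : MonoidAlgebra K H) ∈ augIdeal K N := by
    have : geomSum K q x - (q : MonoidAlgebra K H) =
        ∑ j ∈ Finset.range q, (of K H (x ^ j) - 1) := by
      simp [geomSum, Finset.sum_sub_distrib]
    rw [this]
    exact Submodule.sum_mem _ fun j _ => of_sub_one_mem_augIdeal (pow_mem hx j)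
  have h2 : (q : MonoidAlgebra K H) ∈ I ⊔ augIdeal K N := by
    have := sub_mem (Submodule.mem_sup_left hI) (Submodule.mem_sup_right h : _ ∈ I ⊔ _)
    rwa [sub_sub_cancel] at this
  rw [Ideal.eq_top_iff_one]
  have h3 := (I ⊔ augIdeal K N).mul_mem_left (algebraMap K _ (q : K)⁻¹) h2
  rwa [← map_natCast (algebraMap K (MonoidAlgebra K H)), ← map_mul, inv_mul_cancel₀ hq,
    map_one] at h3

/-- The left ideal of all elements that annihilate `b` from the left. -/
def leftAnnihilator {R : Type*} [Ring R] (b : R) : Ideal R where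
  carrier := {a | a * b = 0}
  zero_mem' := zero_mul b
  add_mem' := fun {x y} hx hy => by
    rw [Set.mem_ofPred_eq] at *; rw [add_mul, hx, hy, add_zero]
  smul_mem' := fun c x hx => by
    rw [Set.mem_ofPred_eq] at *; rw [smul_eq_mul, mul_assoc, hx, mul_zero]

theorem mem_leftAnnihilator {R : Type*} [Ring R] {a b : R} :
    a ∈ leftAnnihilator b ↔ a * b = 0 := Iff.rfl

theorem leftAnnihilator_of_sub_one_ne_top {x : H} (hx : x ≠ 1) :
    leftAnnihilator (of K H x - 1) ≠ ⊤ := by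
  rw [Ne, Ideal.eq_top_iff_one, mem_leftAnnihilator, one_mul, sub_eq_zero]
  intro h
  exact hx (of_injective (h.trans (map_one _).symm))

theorem geomSum_mem_leftAnnihilator {q : ℕ} {x y : H} (hy : y ^ q = 1)
    (hx : x ∈ Subgroup.zpowers y) (hq : q ≠ 0) :
    geomSum K q y ∈ leftAnnihilator (of K H x - 1) := by
  have fin : IsOfFinOrder y := isOfFinOrder_iff_pow_eq_one.2 ⟨q, Nat.pos_of_ne_zero hq, hy⟩
  obtain ⟨k, rfl⟩ := fin.mem_powers_iff_mem_zpowers.2 hx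
  rw [mem_leftAnnihilator]
  have : of K H (y ^ k) - 1 = (of K H y - 1) * ∑ j ∈ Finset.range k, of K H y ^ j := by
    rw [mul_geom_sum, map_pow]
  simp only
  rw [this, ← mul_assoc, geomSum_mul_sub_one hy, zero_mul]

/-- In the group algebra of `ZMod q` every non-trivial element `y` is a generator, so all the sums
attached to such `y` annihilate the same nonzero `z - 1`. The annihilator is a proper left ideal,
which is pulled back along `π` and then extended from `C` to `H`. -/
theorem span_geomSum_ne_top {q : ℕ} (hq : q.Prime) {C : Subgroup H}
    (π : C →* Multiplicative (ZMod q)) :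
    Ideal.span ((fun d : C => geomSum K q (d : H)) '' {d | π d ≠ 1}) ≠ ⊤ := by
  have : Fact q.Prime := ⟨hq⟩
  let z : Multiplicative (ZMod q) := Multiplicative.ofAdd 1
  let J : Ideal (MonoidAlgebra K C) :=
    (leftAnnihilator (of K (Multiplicative (ZMod q)) z - 1)).comap (mapDomainRingHom K π)
  have hz : z ≠ 1 := fun h => one_ne_zero (α := ZMod q) (Multiplicative.ofAdd.injective h)
  have hJ : J ≠ ⊤ := Ideal.comap_ne_top _ (leftAnnihilator_of_sub_one_ne_top hz)
  refine ne_top_of_le_ne_top (span_map_subtype_ne_top hJ) (Ideal.span_mono ?_)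
  rintro _ ⟨d, hd, rfl⟩
  refine ⟨geomSum K q d, ?_, map_geomSum _ _ _⟩
  change mapDomainRingHom K π (geomSum K q d) ∈ leftAnnihilator _
  rw [map_geomSum]
  have hpow : ∀ y : Multiplicative (ZMod q), y ^ q = 1 := fun y => by
    apply Multiplicative.toAdd.injective
    simp
  refine geomSum_mem_leftAnnihilator (hpow _) ?_ hq.ne_zero
  have hy : (Multiplicative.toAdd (π d)) ≠ 0 := fun h => hd (Multiplicative.toAdd.injective h)
  -- The inverse of the residue of `d` modulo `q` is the exponent that takes `π d` to the generator
  -- `z`.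
  refine ⟨((Multiplicative.toAdd (π d))⁻¹).val, ?_⟩
  apply Multiplicative.toAdd.injective
  simp [z, hy]

/-- The cyclic group generated by `x` maps onto `ZMod q` with `x` going to `1`. Elements of infinite
order are included: then `orderOf x = 0` and `ZMod 0` is `ℤ`. -/
theorem exists_ideal_of_dvd_orderOf {q : ℕ} (hq : q.Prime) (hqK : (q : K) ≠ 0) {x : H}
    (hx : q ∣ orderOf x) : ∃ J : Ideal (MonoidAlgebra K H), J ≠ ⊤ ∧ J ⊔ augIdeal K ⊤ = ⊤ := by
  have : Fact q.Prime := ⟨hq⟩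
  let g : Subgroup.zpowers x := ⟨x, Subgroup.mem_zpowers x⟩
  have hg : ∀ y : Subgroup.zpowers x, y ∈ Subgroup.zpowers g := by
    rintro ⟨_, k, rfl⟩
    exact ⟨k, Subtype.ext (by simp [g])⟩
  let e := zmodMulEquivOfGenerator hg (Nat.card_zpowers x)
  let r : Multiplicative (ZMod (orderOf x)) →* Multiplicative (ZMod q) :=
    AddMonoidHom.toMultiplicative (ZMod.castHom hx (ZMod q)).toAddMonoidHom
  let π := r.comp e.symm.toMonoidHom
  refine ⟨_, span_geomSum_ne_top hq π, sup_augIdeal_eq_top_of_geomSum_mem hqK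
    (Subgroup.mem_top x) (Ideal.subset_span ⟨g, ?_, rfl⟩)⟩
  have : e.symm g = Multiplicative.ofAdd 1 := zmodMulEquivOfGenerator_symm_apply_generator _ _
  have h2 : π g = Multiplicative.ofAdd 1 := by
    change r (e.symm g) = _
    rw [this]
    change Multiplicative.ofAdd (ZMod.castHom hx (ZMod q) 1) = _
    rw [map_one]
  intro h
  rw [h2] at h
  exact one_ne_zero (α := ZMod q) (Multiplicative.ofAdd.injective h)

theorem augIdeal_le_span_of_closure {S : Set H} {N : Subgroup H} (hS : N ≤ Subgroup.closure S) :
    augIdeal K N ≤ Ideal.span ((fun n => of K H n - 1) '' S) := by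
  refine Ideal.span_le.2 ?_
  rintro _ ⟨n, hn, rfl⟩
  refine Subgroup.closure_induction (p := fun n _ => of K H n - 1 ∈
    Ideal.span ((fun n => of K H n - 1) '' S)) ?_ ?_ ?_ ?_ (hS hn)
  · intro x hx; exact Ideal.subset_span ⟨x, hx, rfl⟩
  · simp only [map_one, sub_self]; exact zero_mem _
  · intro x y _ _ hx hy
    have : of K H (x * y) - 1 = of K H x * (of K H y - 1) + (of K H x - 1) := by
      rw [map_mul]; noncomm_ring
    rw [this]
    exact add_mem (Ideal.mul_mem_left _ _ hy) hx
  · intro x _ hx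
    have : of K H x⁻¹ - 1 = -of K H x⁻¹ * (of K H x - 1) := by
      rw [mul_sub, neg_mul, ← map_mul, inv_mul_cancel, map_one, mul_one]; noncomm_ring
    rw [this]
    exact Ideal.mul_mem_left _ _ hx

/-- For a perfect group the augmentation ideal is idempotent. -/
theorem augIdeal_le_of_perfect (hH : commutator H = ⊤) {M : Ideal (MonoidAlgebra K H)}
    (hM : ∀ g : H, ∀ d ∈ augIdeal K (⊤ : Subgroup H), (of K H g - 1) * d ∈ M) :
    augIdeal K (⊤ : Subgroup H) ≤ M := by
  have hMM : ∀ e ∈ augIdeal K (⊤ : Subgroup H), ∀ d ∈ augIdeal K (⊤ : Subgroup H), e * d ∈ M := by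
    intro e he d hd
    induction he using Submodule.span_induction with
    | mem x hx => obtain ⟨n, -, rfl⟩ := hx; exact hM n d hd
    | zero => simp
    | add x y _ _ hx hy => rw [add_mul]; exact add_mem hx hy
    | smul r x _ hx => rw [smul_eq_mul, mul_assoc]; exact Ideal.mul_mem_left _ _ hx
  have hg : ∀ g : H, of K H g - 1 ∈ augIdeal K (⊤ : Subgroup H) :=
    fun g => of_sub_one_mem_augIdeal trivial
  have hcl : (⊤ : Subgroup H) ≤ Subgroup.closure (commutatorSet H) := by
    rw [← commutator_eq_closure, hH]
  refine (augIdeal_le_span_of_closure hcl).trans (Ideal.span_le.2 ?_)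
  rintro _ ⟨_, ⟨g, h, rfl⟩, rfl⟩
  let u : MonoidAlgebra K H := (of K H g - 1) * (of K H h - 1) - (of K H h - 1) * (of K H g - 1)
  have hu : u ∈ M := sub_mem (hMM _ (hg g) _ (hg h)) (hMM _ (hg h) _ (hg g))
  have huA : u ∈ augIdeal K (⊤ : Subgroup H) :=
    sub_mem (Ideal.mul_mem_left _ _ (hg h)) (Ideal.mul_mem_left _ _ (hg g))
  -- `⁅g, h⁆ - 1 = (gh - hg) g⁻¹h⁻¹`. Since `M` is only a left ideal, the right factor `k = g⁻¹h⁻¹`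
  -- is written as `1 + (k - 1)`, so that both terms are products of augmentation elements or sums
  -- of these.
  have hcu : of K H ⁅g, h⁆ - 1 = u + u * (of K H (g⁻¹ * h⁻¹) - 1) := by
    have e1 : u = of K H (g * h) - of K H (h * g) := by
      simp only [u, map_mul]; noncomm_ring
    have e2 : u + u * (of K H (g⁻¹ * h⁻¹) - 1) = u * of K H (g⁻¹ * h⁻¹) := by noncomm_ring
    rw [e2, e1, sub_mul, ← map_mul, ← map_mul, ← map_one (of K H)]
    congr 2
    · rw [commutatorElement_def]; group
    · group
  simp only [SetLike.mem_coe]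
  rw [hcu]
  exact add_mem hu (hMM _ huA _ (hg _))

/-- Finite generation of `H` makes the augmentation ideal `A` finitely generated, hence it has a
maximal proper left subideal `M`. The simple module `A / M` is not trivial, since otherwise `A * A ≤
M` while `A` is idempotent. The required ideal is the annihilator of a vector of `A / M` that is
moved. -/
theorem exists_ideal_of_fg_of_perfect [Nontrivial H] [hfg : Group.FG H] (hH : commutator H = ⊤) :
    ∃ J : Ideal (MonoidAlgebra K H), J ≠ ⊤ ∧ J ⊔ augIdeal K ⊤ = ⊤ := by
  obtain ⟨S, hS⟩ := Group.fg_def.1 hfg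
  have hfgA : (augIdeal K (⊤ : Subgroup H)).FG := by
    classical
    refine ⟨S.image (fun n => of K H n - 1), le_antisymm ?_ ?_⟩
    · refine Submodule.span_le.2 ?_
      intro a ha
      obtain ⟨n, -, rfl⟩ := Finset.mem_image.1 (Finset.mem_coe.1 ha)
      exact of_sub_one_mem_augIdeal trivial
    · have := augIdeal_le_span_of_closure (K := K) (N := ⊤) hS.ge
      rwa [Finset.coe_image]
  have hne : augIdeal K (⊤ : Subgroup H) ≠ ⊥ := by
    obtain ⟨x, hx⟩ := exists_ne (1 : H)
    intro h
    have := of_sub_one_mem_augIdeal (K := K) (N := ⊤) (Subgroup.mem_top x)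
    rw [h, Submodule.mem_bot, sub_eq_zero] at this
    exact hx (of_injective (this.trans (map_one _).symm))
  have hco := CompleteLattice.Iic_coatomic_of_compact_element
    ((Submodule.fg_iff_compact _).1 hfgA)
  obtain ⟨⟨M, hMle⟩, hM, -⟩ := (eq_top_or_exists_le_coatom (⊥ : Set.Iic (augIdeal K (⊤ : Subgroup H)))).resolve_left
    (fun h => hne (congrArg Subtype.val h).symm)
  have hMne : M ≠ augIdeal K (⊤ : Subgroup H) := fun h => hM.1 (Subtype.ext h)
  have hMmax : ∀ M', M < M' → M' ≤ augIdeal K (⊤ : Subgroup H) → M' = augIdeal K (⊤ : Subgroup H) :=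
    fun M' h1 h2 => congrArg Subtype.val (hM.2 ⟨M', h2⟩ h1)
  have hex : ∃ g : H, ∃ d ∈ augIdeal K (⊤ : Subgroup H), (of K H g - 1) * d ∉ M := by
    by_contra! h
    exact hMne (le_antisymm hMle (augIdeal_le_of_perfect hH h))
  obtain ⟨g, d, hd, hgd⟩ := hex
  let J : Ideal (MonoidAlgebra K H) := Submodule.comap (LinearMap.toSpanSingleton _ _ d) M
  have memJ : ∀ a, a ∈ J ↔ a * d ∈ M := fun a => Iff.rfl
  refine ⟨J, fun h => hgd (M.mul_mem_left _ ?_), ?_⟩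
  · have := (memJ 1).1 (h ▸ Submodule.mem_top)
    rwa [one_mul] at this
  -- As `(g - 1) * d` generates `A` modulo `M`, some `b` satisfies `d ≡ b * (g - 1) * d`; thus `1 -
  -- b * (g - 1)` annihilates `d` modulo `M`.
  · have htop := hMmax (M ⊔ Ideal.span {(of K H g - 1) * d})
      (left_lt_sup.2 fun h => hgd (h (Ideal.subset_span rfl)))
      (sup_le hMle (Ideal.span_le.2 (Set.singleton_subset_iff.2 (Ideal.mul_mem_left _ _ hd))))
    rw [← htop] at hd
    obtain ⟨m, hm, y, hy, hmy⟩ := Submodule.mem_sup.1 hd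
    obtain ⟨b, rfl⟩ := Ideal.mem_span_singleton'.1 hy
    rw [Ideal.eq_top_iff_one]
    refine Submodule.mem_sup.2 ⟨1 - b * (of K H g - 1), ?_, b * (of K H g - 1),
      Ideal.mul_mem_left _ _ (of_sub_one_mem_augIdeal trivial), by noncomm_ring⟩
    rw [memJ]
    have : (1 - b * (of K H g - 1)) * d = m := by
      rw [sub_mul, one_mul, mul_assoc, sub_eq_iff_eq_add]
      exact hmy.symm
    rwa [this]

/-- The annihilator of `v` works: by simplicity `v = b * (g - 1) • v` for some `b`, so `1 - b * (g -
1)` lies in it. -/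
theorem exists_ideal_of_isSimpleModule {V : Type*} [AddCommGroup V] [Module (MonoidAlgebra K H) V]
    [IsSimpleModule (MonoidAlgebra K H) V] {g : H} {v : V} (hv : (of K H g - 1) • v ≠ 0) :
    ∃ J : Ideal (MonoidAlgebra K H), J ≠ ⊤ ∧ J ⊔ augIdeal K ⊤ = ⊤ := by
  have hspan := IsSimpleModule.span_singleton_eq_top (MonoidAlgebra K H) hv
  obtain ⟨b, hb⟩ := Submodule.mem_span_singleton.1 (hspan ▸ Submodule.mem_top : v ∈ _)
  let J : Ideal (MonoidAlgebra K H) := LinearMap.ker (LinearMap.toSpanSingleton _ _ v)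
  have memJ : ∀ a, a ∈ J ↔ a • v = 0 := fun a => Iff.rfl
  refine ⟨J, ?_, ?_⟩
  · intro h
    have := (memJ 1).1 (h ▸ Submodule.mem_top)
    rw [one_smul] at this
    exact hv (by rw [this, smul_zero])
  · rw [Ideal.eq_top_iff_one]
    refine Submodule.mem_sup.2 ⟨1 - b * (of K H g - 1), ?_, b * (of K H g - 1),
      Ideal.mul_mem_left _ _ (of_sub_one_mem_augIdeal trivial), by noncomm_ring⟩
    rw [memJ, sub_smul, one_smul, mul_smul, hb, sub_self]

theorem exists_ideal_of_hasNontrivialIrreducibleRep (h : HasNontrivialIrreducibleRep K H) :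
    ∃ J : Ideal (MonoidAlgebra K H), J ≠ ⊤ ∧ J ⊔ augIdeal K ⊤ = ⊤ := by
  obtain ⟨V, _, _, ρ, hρ, g, hg⟩ := h
  obtain ⟨v, hv⟩ : ∃ v : V, ρ g v ≠ v := by
    by_contra! h
    exact hg (LinearMap.ext h)
  have hs : IsSimpleModule (MonoidAlgebra K H) ρ.asModule :=
    (Representation.irreducible_iff_isSimpleModule_asModule ρ).1 hρ
  refine exists_ideal_of_isSimpleModule (g := g) (v := ρ.asModuleEquiv.symm v) fun h => hv ?_
  have := congrArg ρ.asModuleEquiv h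
  rw [Representation.asModuleEquiv_map_smul, LinearEquiv.apply_symm_apply, map_zero, map_sub,
    Representation.asAlgebraHom_of, map_one, LinearMap.sub_apply, Module.End.one_apply] at this
  exact sub_eq_zero.1 this

theorem map_subtype_mem_augIdeal {T : Subgroup H} {D : Subgroup T} {a : MonoidAlgebra K T}
    (ha : a ∈ augIdeal K D) : mapDomainRingHom K T.subtype a ∈ augIdeal K (D.map T.subtype) := by
  induction ha using Submodule.span_induction with
  | mem x hx =>
    obtain ⟨n, hn, rfl⟩ := hx
    simp only [map_sub, map_one]
    have e : mapDomainRingHom K T.subtype (of K T n) = of K H n := by simp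
    rw [e]
    exact of_sub_one_mem_augIdeal ⟨n, hn, rfl⟩
  | zero => simp
  | add x y _ _ hx hy => rw [map_add]; exact add_mem hx hy
  | smul r x _ hx => rw [smul_eq_mul, map_mul]; exact Ideal.mul_mem_left _ _ hx

theorem span_map_subtype_sup_augIdeal {T : Subgroup H} {D : Subgroup T}
    {J : Ideal (MonoidAlgebra K T)} (h : J ⊔ augIdeal K D = ⊤) :
    Ideal.span (mapDomainRingHom K T.subtype '' (J : Set (MonoidAlgebra K T))) ⊔
      augIdeal K (D.map T.subtype) = ⊤ := by
  rw [Ideal.eq_top_iff_one] at h ⊢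
  obtain ⟨a, ha, b, hb, hab⟩ := Submodule.mem_sup.1 h
  refine Submodule.mem_sup.2 ⟨_, Ideal.subset_span ⟨a, ha, rfl⟩, _, map_subtype_mem_augIdeal hb, ?_⟩
  rw [← map_add, hab, map_one]

end Augmentation

/-! ### Locally cyclic groups -/

section LocallyCyclic

theorem mem_zpowers_of_pow_prime_eq_one {G : Type*} [Group G] {q : ℕ} (hq : q.Prime) {x y : G}
    (hx : x ^ q = 1) (hy : y ∈ Subgroup.zpowers x) (hy1 : y ≠ 1) : x ∈ Subgroup.zpowers y := by
  obtain ⟨k, rfl⟩ := hy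
  have hk : ¬ (q : ℤ) ∣ k := by
    rintro ⟨m, rfl⟩
    exact hy1 (by simp only [zpow_mul, zpow_natCast, hx, one_zpow])
  obtain ⟨u, v, huv⟩ := ((Nat.prime_iff_prime_int.1 hq).coprime_iff_not_dvd.2 hk)
  refine ⟨v, ?_⟩
  have : x ^ (u * q + v * k) = x := by rw [huv, zpow_one]
  simp only
  rw [← zpow_mul, mul_comm k v]
  rwa [zpow_add, mul_comm u, zpow_mul, zpow_natCast, hx, one_zpow, one_mul] at this

variable {K : Type*} [Field K]

/-- The group algebra of a locally cyclic group has a proper left ideal that contains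
`1 + y + ⋯ + y ^ (q - 1)` for all `y` of prime order `q`. -/
theorem exists_ideal_of_isLocallyCyclic {Q : Type*} [CommGroup Q] (hQ : IsLocallyCyclic Q) :
    ∃ J : Ideal (MonoidAlgebra K Q), J ≠ ⊤ ∧
      ∀ q : ℕ, q.Prime → ∀ y : Q, y ≠ 1 → y ^ q = 1 → geomSum K q y ∈ J := by
  classical
  -- Local cyclicity makes the `q`-torsion a cyclic group of order `q` or `1`; `x` is its generator,
  -- with `x = 1` when there is no `q`-torsion.
  have hx : ∀ q : {q : ℕ // q.Prime}, ∃ x : Q, x ^ (q : ℕ) = 1 ∧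
      ∀ y : Q, y ^ (q : ℕ) = 1 → y ∈ Subgroup.zpowers x := by
    rintro ⟨q, hq⟩
    by_cases h : ∃ x : Q, x ≠ 1 ∧ x ^ q = 1
    · obtain ⟨x, hx1, hx⟩ := h
      refine ⟨x, hx, fun y hy => ?_⟩
      have hcyc := hQ (Subgroup.closure {x, y}) ⟨{x, y}, by simp⟩
      obtain ⟨⟨z, hz⟩, hgen⟩ := hcyc.exists_generator
      have hzq : z ^ q = 1 := by
        have hle : Subgroup.closure {x, y} ≤ (powMonoidHom q : Q →* Q).ker := by
          rw [Subgroup.closure_le]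
          rintro w (rfl | rfl)
          · exact hx
          · exact hy
        exact hle hz
      have mem : ∀ w ∈ Subgroup.closure {x, y}, w ∈ Subgroup.zpowers z := by
        intro w hw
        obtain ⟨k, hk⟩ := hgen ⟨w, hw⟩
        exact ⟨k, congrArg Subtype.val hk⟩
      have hzx : z ∈ Subgroup.zpowers x := mem_zpowers_of_pow_prime_eq_one hq hzq
        (mem x (Subgroup.subset_closure (by simp))) hx1
      exact (Subgroup.zpowers_le.2 hzx) (mem y (Subgroup.subset_closure (by simp)))
    · push Not at h
      refine ⟨1, one_pow _, fun y hy => ?_⟩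
      have : y = 1 := by
        by_contra hne
        exact h y hne hy
      rw [this]; exact one_mem _
  choose x hx hgen using hx
  let X : {q : ℕ // q.Prime} → Set (MonoidAlgebra K Q) :=
    fun q => geomSum K (q : ℕ) '' {y | y ∈ Subgroup.zpowers (x q) ∧ y ≠ 1}
  -- The torsion subgroups for distinct primes are independent, so each prime is treated separately;
  -- the empty set and `D = ⊥` fill the base slot of the gluing lemma.
  refine ⟨Ideal.span (∅ ∪ ⋃ q, X q), ?_, ?_⟩
  · refine span_union_iUnion_ne_top (D := ⊥) (C := fun q => Subgroup.zpowers (x q))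
      (fun _ _ _ c _ d _ => mul_comm c d) ?_ (Set.empty_subset _) ?_ (by simp) ?_
    · intro q s hqs
      have hle : (⊥ ⊔ ⨆ r ∈ s, Subgroup.zpowers (x r)) ≤
          (powMonoidHom (∏ r ∈ s, (r : ℕ)) : Q →* Q).ker := by
        refine sup_le bot_le (iSup₂_le fun r hr => Subgroup.zpowers_le.2 ?_)
        change x r ^ (∏ r ∈ s, (r : ℕ)) = 1
        obtain ⟨m, hm⟩ := Finset.dvd_prod_of_mem (fun r : {q : ℕ // q.Prime} => (r : ℕ)) hr
        rw [hm, pow_mul, hx, one_pow]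
      rw [Subgroup.disjoint_def]
      intro y hy hyq
      have h1 : y ^ (∏ r ∈ s, (r : ℕ)) = 1 := hle hy
      have h2 : y ^ (q : ℕ) = 1 := by
        have : Subgroup.zpowers (x q) ≤ (powMonoidHom (q : ℕ) : Q →* Q).ker :=
          Subgroup.zpowers_le.2 (hx q)
        exact this hyq
      have hcop : Nat.Coprime (∏ r ∈ s, (r : ℕ)) q := by
        refine Nat.Coprime.prod_left fun r hr => (Nat.coprime_primes r.2 q.2).2 fun h => hqs ?_
        rwa [← Subtype.ext h]
      have := pow_gcd_eq_one.2 ⟨h1, h2⟩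
      rwa [hcop.gcd_eq_one, pow_one] at this
    · rintro q _ ⟨y, hy, rfl⟩
      exact geomSum_mem_supported hy.1 _
    · intro q
      by_cases h1 : x q = 1
      · have : X q = ∅ := by
          rw [Set.eq_empty_iff_forall_notMem]
          rintro _ ⟨y, ⟨hy, hy1⟩, rfl⟩
          rw [h1, Subgroup.zpowers_one_eq_bot, Subgroup.mem_bot] at hy
          exact hy1 hy
        simp [this]
      · refine ne_top_of_le_ne_top (leftAnnihilator_of_sub_one_ne_top h1) (Ideal.span_le.2 ?_)
        rintro _ ⟨y, ⟨hy, hy1⟩, rfl⟩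
        refine geomSum_mem_leftAnnihilator ?_
          (mem_zpowers_of_pow_prime_eq_one q.2 (hx q) hy hy1) q.2.ne_zero
        have : Subgroup.zpowers (x q) ≤ (powMonoidHom (q : ℕ) : Q →* Q).ker :=
          Subgroup.zpowers_le.2 (hx q)
        exact this hy
  · intro q hq y hy1 hy
    exact Ideal.subset_span (Or.inr (Set.mem_iUnion.2 ⟨⟨q, hq⟩, y, ⟨hgen ⟨q, hq⟩ y hy, hy1⟩, rfl⟩))

end LocallyCyclic

/-! ### Torsion-free abelian groups: embedding into the `q`-adic numbers -/

section TorsionFree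

/-- Over `ℤ` a maximal independent set need not span, but an element with no nonzero multiple in the
span could be adjoined. -/
theorem exists_maximal_linearIndepOn_of_subset {M : Type*} [AddCommGroup M]
    {T E : Set M} (hT : LinearIndepOn ℤ id T) (hTE : T ⊆ E) :
    ∃ S : Set M, T ⊆ S ∧ S ⊆ E ∧ LinearIndepOn ℤ id S ∧
      ∀ e ∈ E, ∃ a : ℤ, a ≠ 0 ∧ a • e ∈ Submodule.span ℤ S := by
  obtain ⟨S, hTS, hS⟩ := zorn_subset_nonempty {S : Set M | S ⊆ E ∧ LinearIndepOn ℤ id S}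
    (fun c hc hchain _ => ⟨⋃₀ c, ⟨Set.sUnion_subset fun s hs => (hc hs).1,
      linearIndepOn_sUnion_of_directed hchain.directedOn fun s hs => (hc hs).2⟩,
      fun s hs => Set.subset_sUnion_of_mem hs⟩) T ⟨hTE, hT⟩
  refine ⟨S, hTS, hS.prop.1, hS.prop.2, fun e he => ?_⟩
  by_contra! h
  have hind : LinearIndepOn ℤ id ({e} : Set M) := by
    refine LinearIndepOn.singleton' fun a ha => ?_
    by_contra ha0
    exact h a ha0 (by rw [id] at ha; rw [ha]; exact zero_mem _)
  have hdis : Disjoint (Submodule.span ℤ S) (Submodule.span ℤ {e}) := by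
    rw [Submodule.disjoint_def]
    intro y hy hye
    obtain ⟨a, rfl⟩ := Submodule.mem_span_singleton.1 hye
    by_cases ha : a = 0
    · rw [ha, zero_smul]
    · exact absurd hy (h a ha)
  have hmem : e ∈ S := hS.le_of_ge
    (y := S ∪ {e}) ⟨Set.union_subset hS.prop.1 (Set.singleton_subset_iff.2 he),
      hS.prop.2.id_union hind hdis⟩ Set.subset_union_left (Or.inr rfl)
  exact h 1 one_ne_zero (by rw [one_smul]; exact Submodule.subset_span hmem)

/-- An injective assignment on a maximal independent subset of a torsion-free abelian group with
independent values in a divisible group extends to an injective homomorphism. -/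
theorem exists_injective_extension {M N : Type*} [AddCommGroup M] [AddCommGroup N]
    (hM : ∀ x : M, ∀ a : ℤ, a ≠ 0 → a • x = 0 → x = 0) (hN : Module.Baer ℤ N)
    {B : Set M} (hB : LinearIndepOn ℤ id B)
    (hmax : ∀ x, ∃ a : ℤ, a ≠ 0 ∧ a • x ∈ Submodule.span ℤ B)
    {w : B → N} (hw : LinearIndependent ℤ w) :
    ∃ φ : M →ₗ[ℤ] N, (∀ b : B, φ b = w b) ∧ Function.Injective φ := by
  have hB' : LinearIndependent ℤ (fun b : B => (b : M)) := hB
  let b := Module.Basis.span hB'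
  have hr : Submodule.span ℤ (Set.range fun b : B => (b : M)) = Submodule.span ℤ B := by
    rw [Subtype.range_coe]
  obtain ⟨φ, hφ⟩ := hN.extension_property (Submodule.subtype _) (Submodule.subtype_injective _)
    (b.constr ℤ w)
  have hφw : ∀ i : B, φ i = w i := by
    intro i
    have := LinearMap.congr_fun hφ (b i)
    rw [LinearMap.comp_apply, Module.Basis.constr_basis, Submodule.subtype_apply] at this
    rw [← this]
    exact congrArg φ (congrArg Subtype.val (Module.Basis.span_apply hB' i)).symm
  refine ⟨φ, hφw, ?_⟩
  -- `φ` is injective on the span of `B`, and every element has a nonzero multiple there, so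
  -- torsion-freeness finishes.
  rw [injective_iff_map_eq_zero]
  intro x hx
  obtain ⟨a, ha, hax⟩ := hmax x
  refine hM x a ha ?_
  rw [← hr] at hax
  obtain ⟨c, hc⟩ := (Finsupp.mem_span_range_iff_exists_finsupp).1 hax
  have h0 : φ (a • x) = 0 := by rw [map_smul, hx, smul_zero]
  rw [← hc, Finsupp.sum, map_sum] at h0
  have hc0 : c = 0 := by
    refine (linearIndependent_iff.1 hw) c ?_
    rw [Finsupp.linearCombination_apply, Finsupp.sum, ← h0]
    refine Finset.sum_congr rfl fun i _ => ?_
    rw [map_smul, hφw]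
  rw [← hc, hc0, Finsupp.sum_zero_index]

theorem exists_prime_natCast_ne_zero (K : Type*) [Field K] : ∃ q : ℕ, q.Prime ∧ (q : K) ≠ 0 := by
  by_cases h : ((2 : ℕ) : K) = 0
  · refine ⟨3, Nat.prime_three, fun h3 => one_ne_zero (α := K) ?_⟩
    push_cast at h h3
    linear_combination h3 - h
  · exact ⟨2, Nat.prime_two, h⟩

/-- `ℚ_[q]` is uncountable, hence of infinite dimension over `ℚ`. -/
theorem exists_linearIndependent_padic (q : ℕ) [Fact q.Prime] (B : Type*) [Countable B] :
    ∃ w : B → ℚ_[q], LinearIndependent ℤ w := by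
  let b := Module.Basis.ofVectorSpace ℚ ℚ_[q]
  have hinf : Infinite (Module.Basis.ofVectorSpaceIndex ℚ ℚ_[q]) := by
    by_contra hfin
    rw [not_infinite_iff_finite] at hfin
    have : Module.Finite ℚ ℚ_[q] := Module.Finite.of_basis b
    have hcount : Countable ℚ_[q] := (b.equivFun).injective.countable
    have h1 := continuum_le_cardinal_of_nontriviallyNormedField ℚ_[q]
    have h2 := Cardinal.mk_le_aleph0_iff.2 hcount
    exact absurd (h1.trans h2) (not_le.2 Cardinal.aleph0_lt_continuum)
  obtain ⟨f, hf⟩ := exists_injective_nat B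
  have hli : LinearIndependent ℚ (fun i : B => b (Infinite.natEmbedding _ (f i))) :=
    b.linearIndependent.comp _ ((Infinite.natEmbedding _).injective.comp hf)
  exact ⟨_, hli.restrict_scalars (R := ℤ) (fun a b hab => by simpa using hab)⟩

theorem baer_of_forall_smul {N : Type*} [AddCommGroup N]
    (h : ∀ a : ℤ, a ≠ 0 → ∀ y : N, ∃ x : N, a • x = y) : Module.Baer ℤ N := by
  classical
  let : DivisibleBy N ℤ :=
    { div := fun y a => if ha : a = 0 then 0 else (h a ha y).choose
      div_zero := fun y => by simp
      div_cancel := fun {a} y ha => by simp only [ha, dite_false]; exact (h a ha y).choose_spec }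
  exact Module.Baer.of_divisible N

variable {K A : Type*} [Field K] [CommGroup A]

theorem smul_ofMul_eq_zero_iff (hA : ∀ x : A, ∀ n : ℕ, n ≠ 0 → x ^ n = 1 → x = 1)
    (x : Additive A) (a : ℤ) (ha : a ≠ 0) (h : a • x = 0) : x = 0 := by
  have h' : x.toMul ^ a = 1 := h
  refine hA x.toMul a.natAbs (Int.natAbs_ne_zero.2 ha) ?_
  rwa [pow_natAbs_eq_one]

/-- The subgroup of elements with `q`-adically integral image. -/
noncomputable def padicIntegral {q : ℕ} [Fact q.Prime] (φ : Additive A →ₗ[ℤ] ℚ_[q]) : Subgroup A where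
  carrier := {a | ‖φ (Additive.ofMul a)‖ ≤ 1}
  one_mem' := by simp
  mul_mem' {a b} ha hb := by
    change ‖φ (Additive.ofMul a + Additive.ofMul b)‖ ≤ 1
    rw [map_add]
    exact (Padic.nonarchimedean _ _).trans (max_le ha hb)
  inv_mem' {a} ha := by
    change ‖φ (-Additive.ofMul a)‖ ≤ 1
    rwa [map_neg, norm_neg]

/-- The image of an element of `padicIntegral φ` as a `q`-adic integer. -/
noncomputable def padicImage {q : ℕ} [Fact q.Prime] (φ : Additive A →ₗ[ℤ] ℚ_[q]) (a : padicIntegral φ) : ℤ_[q] :=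
  ⟨φ (Additive.ofMul (a : A)), a.2⟩

theorem padicImage_mul {q : ℕ} [Fact q.Prime] (φ : Additive A →ₗ[ℤ] ℚ_[q]) (a b : padicIntegral φ) :
    padicImage φ (a * b) = padicImage φ a + padicImage φ b :=
  Subtype.ext (map_add φ (Additive.ofMul (a : A)) (Additive.ofMul (b : A)))

/-- The homomorphism to `ZMod q` given by the residues of `q`-adic integers. -/
noncomputable def padicResidue {q : ℕ} [Fact q.Prime] (φ : Additive A →ₗ[ℤ] ℚ_[q]) :
    padicIntegral φ →* Multiplicative (ZMod q) :=
  MonoidHom.mk' (fun a => Multiplicative.ofAdd (PadicInt.toZMod (padicImage φ a))) fun a b => by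
    rw [padicImage_mul, map_add, ofAdd_add]

/-- A non-trivial divisible `D` contains an element whose image is a `q`-adic unit. Its residue is
nonzero, so its geometric sum is among the generators of the ideal. -/
theorem exists_ideal_of_injective_padic {q : ℕ} [Fact q.Prime] (hq : (q : K) ≠ 0)
    (φ : Additive A →ₗ[ℤ] ℚ_[q]) (hφ : Function.Injective φ) :
    ∃ J : Ideal (MonoidAlgebra K A), J ≠ ⊤ ∧ ∀ D : Subgroup A, D ≠ ⊥ →
      (∀ x ∈ D, ∀ n : ℕ, n ≠ 0 → ∃ y ∈ D, y ^ n = x) → J ⊔ augIdeal K D = ⊤ := by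
  have hp : q.Prime := Fact.out
  refine ⟨_, span_geomSum_ne_top hp (padicResidue φ), fun D hD hdiv => ?_⟩
  obtain ⟨x, hx, hx1⟩ := D.bot_or_exists_ne_one.resolve_left hD
  obtain ⟨y, hy, hy1⟩ : ∃ y ∈ D, ‖φ (Additive.ofMul y)‖ = 1 := by
    have hx0 : φ (Additive.ofMul x) ≠ 0 := fun h => hx1 (hφ (h.trans (map_zero φ).symm))
    have hn : ‖((q : ℕ) : ℚ_[q])‖ = (q : ℝ)⁻¹ := Padic.norm_p
    have hq0 : (q : ℝ) ≠ 0 := Nat.cast_ne_zero.2 hp.ne_zero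
    have hnorm := Padic.norm_eq_zpow_neg_valuation hx0
    -- The valuation is brought to zero by a `q ^ n`-th root in `D` if it is `n`, and by a `q ^
    -- n`-th power if it is `-n`.
    obtain ⟨n, hn' | hn'⟩ := Int.eq_nat_or_neg (φ (Additive.ofMul x)).valuation
    · obtain ⟨y, hy, hyx⟩ := hdiv x hx (q ^ n) (pow_ne_zero _ hp.ne_zero)
      refine ⟨y, hy, ?_⟩
      have h1 : ‖φ (Additive.ofMul x)‖ = ((q : ℝ)⁻¹) ^ n * ‖φ (Additive.ofMul y)‖ := by
        rw [← hyx, ofMul_pow, map_nsmul, nsmul_eq_mul, norm_mul, Nat.cast_pow, norm_pow, hn]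
      rw [h1, hn', zpow_neg, zpow_natCast, inv_pow] at hnorm
      have : ((q : ℝ) ^ n)⁻¹ ≠ 0 := inv_ne_zero (pow_ne_zero _ hq0)
      exact mul_left_cancel₀ this (hnorm.trans (mul_one _).symm)
    · refine ⟨x ^ (q ^ n), pow_mem hx _, ?_⟩
      rw [ofMul_pow, map_nsmul, nsmul_eq_mul, norm_mul, Nat.cast_pow, norm_pow, hn, hnorm, hn',
        neg_neg, zpow_natCast, inv_pow, inv_mul_cancel₀ (pow_ne_zero _ hq0)]
  refine sup_augIdeal_eq_top_of_geomSum_mem hq hy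
    (Ideal.subset_span ⟨⟨y, (show ‖φ (Additive.ofMul y)‖ ≤ 1 from hy1.le)⟩, ?_, rfl⟩)
  intro h
  have h0 : PadicInt.toZMod (padicImage φ ⟨y, hy1.le⟩) = 0 :=
    Multiplicative.ofAdd.injective h
  rw [← RingHom.mem_ker, PadicInt.ker_toZMod, IsLocalRing.mem_maximalIdeal,
    PadicInt.mem_nonunits] at h0
  exact h0.ne hy1

end TorsionFree

/-! ### Torsion-free abelian groups of infinite rank: embedding into units of a field -/

section TorsionFreeInfinite

universe u v

variable {K : Type v} [Field K]

/-- The variables of a polynomial ring are multiplicatively independent units in an extension field. -/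
theorem linearIndependent_units_of_mvPolynomial {L B : Type*} [Field L]
    [Algebra (MvPolynomial B K) L]
    (hinj : Function.Injective (algebraMap (MvPolynomial B K) L)) (x : B → Lˣ)
    (hx : ∀ b, (x b : L) = algebraMap (MvPolynomial B K) L (MvPolynomial.X b)) :
    LinearIndependent ℤ (fun b => Additive.ofMul (x b)) := by
  classical
  rw [linearIndependent_iff']
  intro s g hg
  have h1 : ∏ i ∈ s, x i ^ g i = 1 := by
    have := congrArg Additive.toMul hg
    rwa [toMul_sum] at this
  -- Separating positive and negative exponents turns the relation into an equality of two
  -- monomials.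
  have h2 : ∏ i ∈ s, x i ^ (g i).toNat = ∏ i ∈ s, x i ^ (-g i).toNat := by
    rw [← div_eq_one, ← Finset.prod_div_distrib, ← h1]
    refine Finset.prod_congr rfl fun i _ => ?_
    rw [div_eq_mul_inv, ← zpow_natCast, ← zpow_natCast, ← zpow_sub]
    congr 1
    omega
  have mon : ∀ n : B → ℕ, ((∏ i ∈ s, x i ^ n i : Lˣ) : L) =
      algebraMap (MvPolynomial B K) L (MvPolynomial.monomial (∑ i ∈ s, Finsupp.single i (n i)) 1) := by
    intro n
    rw [MvPolynomial.monomial_sum_one, Units.coe_prod, map_prod]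
    refine Finset.prod_congr rfl fun i _ => ?_
    rw [Units.val_pow_eq_pow_val, hx, ← map_pow, MvPolynomial.X_pow_eq_monomial]
  have h3 := hinj ((mon _).symm.trans ((congrArg Units.val h2).trans (mon _)))
  have h4 := MvPolynomial.monomial_left_injective (one_ne_zero (α := K)) h3
  intro i hi
  have h5 := DFunLike.congr_fun h4 i
  simp only [Finsupp.coe_finsetSum, Finset.sum_apply, Finsupp.single_apply, Finset.sum_ite_eq',
    hi, if_true] at h5
  omega

theorem baer_units (L : Type*) [Field L] [IsAlgClosed L] : Module.Baer ℤ (Additive Lˣ) := by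
  refine baer_of_forall_smul fun a ha y => ?_
  have nat : ∀ n : ℕ, n ≠ 0 → ∀ y : Lˣ, ∃ x : Lˣ, x ^ n = y := by
    intro n hn y
    obtain ⟨z, hz⟩ := IsAlgClosed.exists_pow_nat_eq (y : L) (Nat.pos_of_ne_zero hn)
    have hz0 : z ≠ 0 := by
      rintro rfl
      rw [zero_pow hn] at hz
      exact y.ne_zero hz.symm
    exact ⟨Units.mk0 z hz0, Units.ext (by simpa using hz)⟩
  obtain ⟨x, hx⟩ := nat a.natAbs (Int.natAbs_ne_zero.2 ha) y.toMul
  rcases Int.natAbs_eq a with h | h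
  · refine ⟨Additive.ofMul x, ?_⟩
    rw [h, natCast_zsmul, ← ofMul_pow, hx]; rfl
  · refine ⟨Additive.ofMul x⁻¹, ?_⟩
    rw [h, neg_smul, natCast_zsmul, ← ofMul_pow, inv_pow, hx]; simp

/-- For an infinite set `B` there is an algebraically closed field extension with a subfield `E`
such that the group of units of `E` has, modulo torsion, a maximal independent family indexed
by `B`. -/
theorem exists_field_with_independent_units (K : Type v) [Field K] (B : Type u) [Infinite B] :
    ∃ (L : Type (max u v)) (_ : Field L) (_ : IsAlgClosed L) (_ : Algebra K L) (E : Subfield L)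
      (w : B → Additive Lˣ), LinearIndependent ℤ w ∧ (∀ b, ((w b).toMul : L) ∈ E) ∧
      ∀ u : Lˣ, (u : L) ∈ E → ∃ a : ℤ, a ≠ 0 ∧
        a • Additive.ofMul u ∈ Submodule.span ℤ (Set.range w) := by
  classical
  let L := AlgebraicClosure (FractionRing (MvPolynomial B K))
  have hinj : Function.Injective (algebraMap (MvPolynomial B K) L) := by
    rw [IsScalarTower.algebraMap_eq (MvPolynomial B K) (FractionRing (MvPolynomial B K)) L]
    exact (algebraMap (FractionRing (MvPolynomial B K)) L).injective.comp
      (IsFractionRing.injective (MvPolynomial B K) (FractionRing (MvPolynomial B K)))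
  let x : B → Lˣ := fun b => Units.mk0 (algebraMap (MvPolynomial B K) L (MvPolynomial.X b)) (by
    rw [Ne, ← map_zero (algebraMap (MvPolynomial B K) L), hinj.eq_iff]
    exact MvPolynomial.X_ne_zero b)
  have hx : LinearIndependent ℤ (fun b => Additive.ofMul (x b)) :=
    linearIndependent_units_of_mvPolynomial hinj x fun b => rfl
  -- `E` is generated by the variables alone, without the constants from `K`, so its cardinality is
  -- that of `B` however large `K` is. This lets a maximal independent set of units of `E` be
  -- indexed by `B`.
  let E : Subfield L := Subfield.closure (Set.range fun b => (x b : L))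
  let T : Set (Additive Lˣ) := Set.range fun b => Additive.ofMul (x b)
  obtain ⟨S, hTS, hSE, hS, hmax⟩ := exists_maximal_linearIndepOn_of_subset (T := T)
    (E := {y | ((y.toMul : Lˣ) : L) ∈ E}) hx.linearIndepOn_id (by
      rintro _ ⟨b, rfl⟩
      exact Subfield.subset_closure ⟨b, rfl⟩)
  have hxinj : Function.Injective (fun b => Additive.ofMul (x b)) := hx.injective
  have hcard : Cardinal.lift.{max u v} (Cardinal.mk B) = Cardinal.lift.{u} (Cardinal.mk S) := by
    have hTB : Cardinal.lift.{u} (Cardinal.mk T) = Cardinal.lift.{max u v} (Cardinal.mk B) :=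
      Cardinal.mk_range_eq_of_injective hxinj
    have hinf : Infinite (Set.range fun b => (x b : L)) := by
      refine Set.infinite_coe_iff.2 (Set.infinite_range_of_injective ?_)
      exact fun a b hab => hxinj (Units.ext hab)
    apply le_antisymm
    · rw [← hTB]
      exact Cardinal.lift_le.2 (Cardinal.mk_le_mk_of_subset hTS)
    · have h1 : Cardinal.mk S ≤ Cardinal.mk E :=
        Cardinal.mk_le_of_injective (f := fun s : S => (⟨_, hSE s.2⟩ : E)) fun a b hab =>
          Subtype.ext (Units.ext (congrArg Subtype.val hab))
      rw [Subfield.cardinalMk_closure] at h1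
      refine (Cardinal.lift_le.2 h1).trans_eq ?_
      exact Cardinal.mk_range_eq_of_injective fun a b hab => hxinj (Units.ext hab)
  obtain ⟨e⟩ := Cardinal.lift_mk_eq'.1 hcard
  refine ⟨L, inferInstance, inferInstance, inferInstance, E, fun b => (e b : Additive Lˣ),
    ?_, fun b => hSE (e b).2, ?_⟩
  · exact LinearIndependent.comp (v := fun s : S => (s : Additive Lˣ)) hS e e.injective
  · intro u hu
    obtain ⟨a, ha, hau⟩ := hmax (Additive.ofMul u) hu
    refine ⟨a, ha, ?_⟩
    have : Set.range (fun b => (e b : Additive Lˣ)) = S := by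
      rw [← Function.comp_def Subtype.val e, EquivLike.range_comp, Subtype.range_coe]
    rwa [this]

/-- The ideal is the kernel of `F : K[A] → L` extending an embedding `ψ` of `A` in `Lˣ` with `B`
sent to the family `w`. For `1 ≠ x ∈ D` some `ψ (x ^ a)` lies in `E`, so `ψ (x ^ a) - 1` is a unit
of `E` and some power of it is `ψ c`. Hence `c⁻¹ * (x ^ a - 1) ^ m` lies in `augIdeal K D` and maps
to `1`. -/
theorem exists_ideal_of_torsionFree_of_infinite {A : Type u} [CommGroup A]
    (hA : ∀ x : A, ∀ n : ℕ, n ≠ 0 → x ^ n = 1 → x = 1)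
    {B : Set (Additive A)} [Infinite B] (hB : LinearIndepOn ℤ id B)
    (hmax : ∀ x, ∃ a : ℤ, a ≠ 0 ∧ a • x ∈ Submodule.span ℤ B) :
    ∃ J : Ideal (MonoidAlgebra K A), J ≠ ⊤ ∧ ∀ D : Subgroup A, D ≠ ⊥ → J ⊔ augIdeal K D = ⊤ := by
  obtain ⟨L, _, _, _, E, w, hw, hwE, hE⟩ := exists_field_with_independent_units K B
  obtain ⟨φ, hφw, hφ⟩ := exists_injective_extension (smul_ofMul_eq_zero_iff hA) (baer_units L)
    hB hmax hw
  let ψ : A →* Lˣ := AddMonoidHom.toMultiplicative φ.toAddMonoidHom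
  have hψ : ∀ a, ψ a = (φ (Additive.ofMul a)).toMul := fun a => rfl
  let F : MonoidAlgebra K A →ₐ[K] L := lift K L A ((Units.coeHom L).comp ψ)
  have hF : ∀ a, F (of K A a) = (ψ a : L) := fun a => lift_of _ _
  refine ⟨RingHom.ker F, RingHom.ker_ne_top _, fun D hD => ?_⟩
  obtain ⟨x, hx, hx1⟩ := D.bot_or_exists_ne_one.resolve_left hD
  obtain ⟨a, ha, hax⟩ := hmax (Additive.ofMul x)
  have hspanE : ∀ y ∈ Submodule.span ℤ B, (((φ y).toMul : Lˣ) : L) ∈ E := by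
    intro y hy
    induction hy using Submodule.span_induction with
    | mem b hb => rw [hφw ⟨b, hb⟩]; exact hwE _
    | zero => rw [map_zero]; exact one_mem E
    | add y z _ _ hy hz => rw [map_add, toMul_add, Units.val_mul]; exact mul_mem hy hz
    | smul c y _ hy =>
      rw [map_smul, toMul_zsmul, Units.val_zpow_eq_zpow_val]; exact zpow_mem hy c
  have hspanψ : ∀ y ∈ Submodule.span ℤ (Set.range w), ∃ c, φ c = y := by
    have : Submodule.span ℤ (Set.range w) ≤ LinearMap.range φ := by
      refine Submodule.span_le.2 ?_
      rintro _ ⟨b, rfl⟩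
      exact ⟨b, hφw b⟩
    exact fun y hy => this hy
  have hψE : (ψ (x ^ a) : L) ∈ E := hspanE _ hax
  have hψ1 : (ψ (x ^ a) : L) - 1 ≠ 0 := by
    intro h
    have h1 : ψ (x ^ a) = 1 := Units.ext (sub_eq_zero.1 h)
    have h2 : a • Additive.ofMul x = 0 := hφ (h1.trans (map_zero φ).symm)
    exact hx1 (smul_ofMul_eq_zero_iff hA _ a ha h2)
  obtain ⟨m, hm, c, hc⟩ : ∃ m : ℕ, m ≠ 0 ∧ ∃ c : A, ψ c = Units.mk0 _ hψ1 ^ m := by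
    obtain ⟨m, hm, hspan⟩ := hE (Units.mk0 _ hψ1) (sub_mem hψE (one_mem E))
    have hspan' : (m.natAbs : ℤ) • Additive.ofMul (Units.mk0 _ hψ1) ∈
        Submodule.span ℤ (Set.range w) := by
      rcases Int.natAbs_eq m with h | h
      · rwa [← h]
      · rw [h, neg_smul] at hspan
        exact neg_mem_iff.1 hspan
    obtain ⟨c, hc⟩ := hspanψ _ hspan'
    exact ⟨m.natAbs, Int.natAbs_ne_zero.2 hm, c.toMul, by
      rw [hψ, ofMul_toMul, hc, natCast_zsmul, toMul_nsmul, toMul_ofMul]⟩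
  have hmem : of K A c⁻¹ * (of K A (x ^ a) - 1) ^ m ∈ augIdeal K D := by
    obtain ⟨k, rfl⟩ := Nat.exists_eq_succ_of_ne_zero hm
    rw [pow_succ]
    exact Ideal.mul_mem_left _ _
      (Ideal.mul_mem_left _ _ (of_sub_one_mem_augIdeal (zpow_mem hx a)))
  rw [Ideal.eq_top_iff_one]
  refine Submodule.mem_sup.2 ⟨1 - of K A c⁻¹ * (of K A (x ^ a) - 1) ^ m, ?_, _, hmem,
    sub_add_cancel _ _⟩
  rw [RingHom.mem_ker, map_sub, map_one, map_mul, map_pow, map_sub, map_one, hF, hF, map_inv, hc]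
  rw [Units.val_inv_eq_inv_val, Units.val_pow_eq_pow_val, Units.val_mk0,
    inv_mul_cancel₀ (pow_ne_zero _ hψ1), sub_self]

/-- The group algebra of a torsion-free abelian group has a proper ideal that is contained in no
maximal ideal on which a non-trivial divisible subgroup acts trivially. -/
theorem exists_ideal_of_torsionFree {A : Type u} [CommGroup A]
    (hA : ∀ x : A, ∀ n : ℕ, n ≠ 0 → x ^ n = 1 → x = 1) :
    ∃ J : Ideal (MonoidAlgebra K A), J ≠ ⊤ ∧ ∀ D : Subgroup A, D ≠ ⊥ →
      (∀ x ∈ D, ∀ n : ℕ, n ≠ 0 → ∃ y ∈ D, y ^ n = x) → J ⊔ augIdeal K D = ⊤ := by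
  obtain ⟨B, -, -, hB, hmax⟩ := exists_maximal_linearIndepOn_of_subset (M := Additive A)
    (T := ∅) (E := Set.univ) (linearIndepOn_empty ℤ id) (Set.subset_univ _)
  -- The two embeddings cover all ranks: countable rank fits in `ℚ_[q]`, and uncountable rank is
  -- infinite.
  by_cases hcount : Countable B
  · obtain ⟨q, hq, hqK⟩ := exists_prime_natCast_ne_zero K
    have : Fact q.Prime := ⟨hq⟩
    obtain ⟨w, hw⟩ := exists_linearIndependent_padic q B
    have hbaer : Module.Baer ℤ ℚ_[q] := baer_of_forall_smul fun a ha y =>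
      ⟨(a : ℚ_[q])⁻¹ * y, by
        rw [zsmul_eq_mul, mul_inv_cancel_left₀ (Int.cast_ne_zero.2 ha)]⟩
    obtain ⟨φ, -, hφ⟩ := exists_injective_extension (smul_ofMul_eq_zero_iff hA) hbaer hB
      (fun x => hmax x trivial) hw
    exact exists_ideal_of_injective_padic hqK φ hφ
  · have : Infinite B := by
      by_contra h
      rw [not_infinite_iff_finite] at h
      exact hcount inferInstance
    obtain ⟨J, hJ, h⟩ := exists_ideal_of_torsionFree_of_infinite (K := K) hA hB
      (fun x => hmax x trivial)
    exact ⟨J, hJ, fun D hD _ => h D hD⟩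

end TorsionFreeInfinite

/-! ### Minimal normal subgroups and the socle -/

section MinimalNormal

variable {G : Type*} [Group G]

theorem IsMinimalNormal.le_of_inf_ne_bot {N L : Subgroup G} (hN : IsMinimalNormal N)
    (hL : L.Normal) (h : N ⊓ L ≠ ⊥) : N ≤ L := by
  have := hN.prop.1
  exact (hN.2 (y := N ⊓ L) ⟨inferInstance, h⟩ inf_le_left).trans inf_le_right

theorem IsMinimalNormal.commute_of_ne {M N : Subgroup G} (hM : IsMinimalNormal M)
    (hN : IsMinimalNormal N) (hne : M ≠ N) {x y : G} (hx : x ∈ M) (hy : y ∈ N) :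
    x * y = y * x := by
  refine Subgroup.commute_of_normal_of_disjoint M N hM.prop.1 hN.prop.1 ?_ x y hx hy
  by_contra h
  rw [disjoint_iff] at h
  exact hne (le_antisymm (hM.le_of_inf_ne_bot hN.prop.1 h)
    (hN.le_of_inf_ne_bot hM.prop.1 (by rwa [inf_comm])))

theorem IsMinimalNormal.disjoint_of_commute {N C : Subgroup G} (hN : IsMinimalNormal N)
    (hnc : ¬ IsMulCommutative N) (hC : C.Normal) (h : ∀ c ∈ C, ∀ n ∈ N, c * n = n * c) :
    Disjoint C N := by
  rw [disjoint_iff, inf_comm]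
  by_contra hne
  have hle := hN.le_of_inf_ne_bot hC hne
  exact hnc ⟨⟨fun a b => Subtype.ext (h a (hle a.2) b b.2)⟩⟩

theorem exists_finset_of_mem_sSup {S : Set (Subgroup G)} {x : G} (hx : x ∈ sSup S) :
    ∃ t : Finset (Subgroup G), (∀ N ∈ t, N ∈ S) ∧ x ∈ t.sup id := by
  classical
  rw [sSup_eq_iSup', iSup_eq_iSup_finset] at hx
  rw [Subgroup.mem_iSup_of_directed] at hx
  · obtain ⟨t, ht⟩ := hx
    refine ⟨t.image Subtype.val, fun N hN => ?_, ?_⟩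
    · obtain ⟨M, -, rfl⟩ := Finset.mem_image.1 hN
      exact M.2
    · rwa [Finset.sup_image, Finset.sup_eq_iSup]
  · exact (Monotone.directed_le fun s t (hst : s ⊆ t) => biSup_mono fun _ h => hst h)

theorem normal_finset_sup {t : Finset (Subgroup G)} (ht : ∀ N ∈ t, N.Normal) :
    (t.sup id).Normal := by
  rw [Finset.sup_id_eq_sSup]
  exact Subgroup.sSup_normal _ ht

/-- A normal subgroup that meets a product of minimal normal subgroups non-trivially contains a
minimal normal subgroup. -/
theorem exists_isMinimalNormal_le {S : Set (Subgroup G)} (hS : ∀ N ∈ S, IsMinimalNormal N)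
    {L : Subgroup G} (hL : L.Normal) (h : L ⊓ sSup S ≠ ⊥) : ∃ N, IsMinimalNormal N ∧ N ≤ L := by
  classical
  obtain ⟨x, hx, hx1⟩ := (L ⊓ sSup S).bot_or_exists_ne_one.resolve_left h
  obtain ⟨t, ht, hxt⟩ := exists_finset_of_mem_sSup hx.2
  have hne : L ⊓ t.sup id ≠ ⊥ := fun h0 => hx1 ((Subgroup.eq_bot_iff_forall _).1 h0 x ⟨hx.1, hxt⟩)
  clear hxt hx hx1 x h
  induction t using Finset.induction_on with
  | empty => exact absurd (by simp) hne
  | insert N t _ ih =>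
    have hN : IsMinimalNormal N := hS N (ht N (Finset.mem_insert_self _ _))
    have ht' : ∀ M ∈ t, M ∈ S := fun M hM => ht M (Finset.mem_insert_of_mem hM)
    have hNn := hN.prop.1
    have hP : (t.sup id).Normal := normal_finset_sup fun M hM => (hS M (ht' M hM)).prop.1
    rw [Finset.sup_insert, id] at hne
    generalize t.sup id = P at *
    by_cases h1 : L ⊓ P = ⊥
    swap
    · exact ih ht' h1
    -- When `L` meets `P` trivially, `L ⊓ (N ⊔ P)` is itself minimal: a non-trivial normal `M`
    -- inside it satisfies `N ≤ M ⊔ P`, and an element `m * p` of `L` with `m ∈ M`, `p ∈ P` has `p ∈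
    -- L ⊓ P = ⊥`.
    refine ⟨L ⊓ (N ⊔ P), ⟨⟨inferInstance, hne⟩, ?_⟩, inf_le_left⟩
    rintro M ⟨hM, hMne⟩ hle
    obtain ⟨m, hm, hm1⟩ := M.bot_or_exists_ne_one.resolve_left hMne
    obtain ⟨n, hn, p, hp, rfl⟩ := Subgroup.mem_sup_of_normal_left.1 (hle hm).2
    have hn1 : n ≠ 1 := by
      rintro rfl
      refine hm1 ((Subgroup.eq_bot_iff_forall _).1 h1 _ ⟨(hle hm).1, ?_⟩)
      rwa [one_mul]
    have hNM : N ≤ M ⊔ P := by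
      refine hN.le_of_inf_ne_bot inferInstance fun h0 => hn1 ?_
      refine (Subgroup.eq_bot_iff_forall _).1 h0 n ⟨hn, ?_⟩
      exact Subgroup.mem_sup_of_normal_left.2 ⟨n * p, hm, p⁻¹, inv_mem hp, mul_inv_cancel_right _ _⟩
    rintro y ⟨hyL, hy⟩
    obtain ⟨m, hm, p, hp, rfl⟩ := Subgroup.mem_sup_of_normal_left.1 ((sup_le hNM le_sup_right) hy)
    have : p = 1 := (Subgroup.eq_bot_iff_forall _).1 h1 p
      ⟨(Subgroup.mul_mem_cancel_left _ (hle hm).1).1 hyL, hp⟩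
    rwa [this, mul_one]

section Abelian

variable {N : Subgroup G}

theorem mul_comm_of_mem (hc : IsMulCommutative N) {x y : G} (hx : x ∈ N) (hy : y ∈ N) :
    x * y = y * x :=
  congrArg Subtype.val (hc.is_comm.comm (⟨x, hx⟩ : N) ⟨y, hy⟩)

/-- The elements of `N` killed by `n` form a normal subgroup of `G`, which is all of `N` once it is
non-trivial. -/
theorem IsMinimalNormal.pow_eq_one (hN : IsMinimalNormal N) (hc : IsMulCommutative N) {n : ℕ}
    {x : G} (hx : x ∈ N) (hx1 : x ≠ 1) (hxn : x ^ n = 1) {y : G} (hy : y ∈ N) : y ^ n = 1 := by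
  have hNn := hN.prop.1
  let P : Subgroup G :=
    { carrier := {x | x ∈ N ∧ x ^ n = 1}
      one_mem' := ⟨one_mem _, one_pow _⟩
      mul_mem' := fun {a b} ha hb => ⟨mul_mem ha.1 hb.1, by
        have hab : Commute a b := mul_comm_of_mem hc ha.1 hb.1
        rw [hab.mul_pow, ha.2, hb.2, one_mul]⟩
      inv_mem' := fun {a} ha => ⟨inv_mem ha.1, by rw [inv_pow, ha.2, inv_one]⟩ }
  have hP : P.Normal := ⟨fun a ha g => ⟨hNn.conj_mem a ha.1 g, by
    rw [conj_pow, ha.2, mul_one, mul_inv_cancel]⟩⟩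
  exact (hN.le_of_inf_ne_bot hP (fun h0 => hx1 ((Subgroup.eq_bot_iff_forall _).1 h0 x
    ⟨hx, hx, hxn⟩)) hy).2

theorem IsMinimalNormal.torsionFree (hN : IsMinimalNormal N) (hc : IsMulCommutative N)
    (ht : ¬ IsMulTorsion N) {x : G} (hx : x ∈ N) {n : ℕ} (hn : n ≠ 0) (hxn : x ^ n = 1) :
    x = 1 := by
  by_contra hx1
  refine ht fun y => isOfFinOrder_iff_pow_eq_one.2 ⟨n, Nat.pos_of_ne_zero hn, Subtype.ext ?_⟩
  exact hN.pow_eq_one hc hx hx1 hxn y.2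

/-- The `n`-th powers of elements of `N` form a normal subgroup of `G`, non-trivial because `N` is
torsion-free. -/
theorem IsMinimalNormal.divisible (hN : IsMinimalNormal N) (hc : IsMulCommutative N)
    (ht : ¬ IsMulTorsion N) {x : G} (hx : x ∈ N) {n : ℕ} (hn : n ≠ 0) : ∃ y ∈ N, y ^ n = x := by
  have hNn := hN.prop.1
  let P : Subgroup G :=
    { carrier := {x | ∃ y ∈ N, y ^ n = x}
      one_mem' := ⟨1, one_mem _, one_pow _⟩
      mul_mem' := by
        rintro _ _ ⟨a, ha, rfl⟩ ⟨b, hb, rfl⟩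
        have hab : Commute a b := mul_comm_of_mem hc ha hb
        exact ⟨a * b, mul_mem ha hb, hab.mul_pow n⟩
      inv_mem' := by
        rintro _ ⟨a, ha, rfl⟩
        exact ⟨a⁻¹, inv_mem ha, inv_pow _ _⟩ }
  have hP : P.Normal := ⟨by
    rintro _ ⟨a, ha, rfl⟩ g
    exact ⟨g * a * g⁻¹, hNn.conj_mem a ha g, conj_pow⟩⟩
  obtain ⟨z, hz, hz1⟩ := N.bot_or_exists_ne_one.resolve_left hN.prop.2
  exact hN.le_of_inf_ne_bot hP (fun h0 => hz1 (hN.torsionFree hc ht hz hn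
    ((Subgroup.eq_bot_iff_forall _).1 h0 (z ^ n) ⟨pow_mem hz n, z, hz, rfl⟩))) hx

theorem IsMinimalNormal.exists_prime_pow_eq_one (hN : IsMinimalNormal N)
    (hc : IsMulCommutative N) (ht : IsMulTorsion N) :
    ∃ q : ℕ, q.Prime ∧ ∀ y ∈ N, y ^ q = 1 := by
  obtain ⟨x, hx, hx1⟩ := N.bot_or_exists_ne_one.resolve_left hN.prop.2
  have h0 : orderOf x ≠ 0 := by
    rw [orderOf_ne_zero_iff]
    exact MonoidHom.isOfFinOrder N.subtype (ht ⟨x, hx⟩)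
  have h1 : orderOf x ≠ 1 := fun h => hx1 (orderOf_eq_one_iff.1 h)
  obtain ⟨q, hq, m, hm⟩ := Nat.exists_prime_and_dvd h1
  refine ⟨q, hq, fun y hy => hN.pow_eq_one hc (pow_mem hx m) ?_ ?_ hy⟩
  · intro h
    have h2 := orderOf_dvd_of_pow_eq_one h
    have hm0 : 0 < m := Nat.pos_of_ne_zero fun h3 => h0 (by rw [hm, h3, mul_zero])
    have h3 := Nat.le_of_dvd hm0 h2
    rw [hm] at h3
    have := hq.two_le
    nlinarith
  · rw [← pow_mul, mul_comm, ← hm, pow_orderOf_eq_one]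

end Abelian

theorem sSup_mul_comm {S : Set (Subgroup G)} (hS : ∀ N ∈ S, IsMinimalNormal N ∧ IsMulCommutative N)
    {x y : G} (hx : x ∈ sSup S) (hy : y ∈ sSup S) : x * y = y * x := by
  have key : sSup S ≤ Subgroup.centralizer ((sSup S : Subgroup G) : Set G) := by
    refine sSup_le fun M hM a ha => ?_
    have h : sSup S ≤ Subgroup.centralizer {a} := by
      refine sSup_le fun N hN b hb => ?_
      rw [Subgroup.mem_centralizer_singleton_iff]
      exact ((hS M hM).1.commute (hS N hN).1 (hS M hM).2 ha hb).symm
    rw [Subgroup.mem_centralizer_iff]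
    intro b hb
    exact Subgroup.mem_centralizer_singleton_iff.mp (h hb)
  exact (Subgroup.mem_centralizer_iff.mp (key hx) y hy).symm

/-- The subgroup generated by the minimal normal subgroups that are abelian but not torsion. -/
def torsionFreeSocle (G : Type*) [Group G] : Subgroup G :=
  sSup {N : Subgroup G | IsMinimalNormal N ∧ IsMulCommutative N ∧ ¬ IsMulTorsion N}

theorem normal_torsionFreeSocle : (torsionFreeSocle G).Normal :=
  Subgroup.sSup_normal _ fun _ hN => hN.1.prop.1

theorem normal_torsionSocle : (torsionSocle G).Normal :=
  Subgroup.sSup_normal _ fun _ hN => hN.1.prop.1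

theorem torsionFreeSocle_comm {x y : G} (hx : x ∈ torsionFreeSocle G)
    (hy : y ∈ torsionFreeSocle G) : x * y = y * x :=
  sSup_mul_comm (fun _ hN => ⟨hN.1, hN.2.1⟩) hx hy

/-- Induction over finite products: by minimality the next factor either meets the product of the
others trivially, giving a direct product, or is already contained in it. -/
theorem eq_one_of_mem_torsionFreeSocle {x : G} (hx : x ∈ torsionFreeSocle G) {n : ℕ} (hn : n ≠ 0)
    (hxn : x ^ n = 1) : x = 1 := by
  classical
  obtain ⟨t, ht, hxt⟩ := exists_finset_of_mem_sSup hx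
  clear hx
  induction t using Finset.induction_on generalizing x with
  | empty => simpa using hxt
  | insert N t _ ih =>
    have hN := ht N (Finset.mem_insert_self _ _)
    have ht' := fun M hM => ht M (Finset.mem_insert_of_mem hM)
    have hNn := hN.1.prop.1
    have hP : (t.sup id).Normal := normal_finset_sup fun M hM => (ht' M hM).1.prop.1
    rw [Finset.sup_insert, id] at hxt
    by_cases h : N ⊓ t.sup id = ⊥
    · obtain ⟨a, ha, b, hb, rfl⟩ := Subgroup.mem_sup_of_normal_left.1 hxt
      have hab : Commute a b := Subgroup.commute_of_normal_of_disjoint _ _ hNn hP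
        (disjoint_iff.2 h) a b ha hb
      rw [hab.mul_pow] at hxn
      have hmem : a ^ n = 1 := by
        refine (Subgroup.eq_bot_iff_forall _).1 h _ ⟨pow_mem ha n, ?_⟩
        rw [eq_inv_of_mul_eq_one_left hxn]
        exact (t.sup id).inv_mem (pow_mem hb n)
      rw [hmem, one_mul] at hxn
      rw [hN.1.torsionFree hN.2.1 hN.2.2 ha hn hmem, ih hxn ht' hb, one_mul]
    · rw [sup_eq_right.2 (hN.1.le_of_inf_ne_bot hP h)] at hxt
      exact ih hxn ht' hxt

theorem isOfFinOrder_of_mem_torsionSocle {x : G} (hx : x ∈ torsionSocle G) : IsOfFinOrder x := by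
  let P : Subgroup G :=
    { carrier := {x | x ∈ torsionSocle G ∧ IsOfFinOrder x}
      one_mem' := ⟨one_mem _, IsOfFinOrder.one⟩
      mul_mem' := fun {a b} ha hb => ⟨mul_mem ha.1 hb.1,
        Commute.isOfFinOrder_mul (torsionSocle_comm ha.1 hb.1) ha.2 hb.2⟩
      inv_mem' := fun {a} ha => ⟨inv_mem ha.1, ha.2.inv⟩ }
  have : torsionSocle G ≤ P := sSup_le fun N hN a ha =>
    ⟨(le_sSup hN : N ≤ torsionSocle G) ha, MonoidHom.isOfFinOrder N.subtype (hN.2.2 ⟨a, ha⟩)⟩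
  exact (this hx).2

theorem disjoint_torsionFreeSocle_torsionSocle :
    Disjoint (torsionFreeSocle G) (torsionSocle G) := by
  rw [Subgroup.disjoint_def]
  intro x hx hxT
  obtain ⟨n, hn, hxn⟩ := isOfFinOrder_iff_pow_eq_one.1 (isOfFinOrder_of_mem_torsionSocle hxT)
  exact eq_one_of_mem_torsionFreeSocle hx hn.ne' hxn

/-- `⁅N, N⁆` is normal in `G` and non-trivial, so minimality gives `N ≤ ⁅N, N⁆`. -/
theorem IsMinimalNormal.commutator_eq_top {N : Subgroup G} (hN : IsMinimalNormal N)
    (hnc : ¬ IsMulCommutative N) : commutator N = ⊤ := by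
  have hNn := hN.prop.1
  have hle : N ≤ ⁅N, N⁆ := by
    refine hN.2 ⟨Subgroup.commutator_normal N N, ?_⟩ (Subgroup.commutator_le_left N N)
    rwa [Ne, Subgroup.commutator_self_eq_bot_iff]
  have : (commutator N).map N.subtype = (⊤ : Subgroup N).map N.subtype := by
    rw [commutator_def, Subgroup.map_commutator, ← MonoidHom.range_eq_map, Subgroup.range_subtype]
    exact le_antisymm (Subgroup.commutator_le_left N N) hle
  exact Subgroup.map_injective N.subtype_injective this

end MinimalNormal

/-! ### The ideals for the three parts of the socle, and the faithful representation -/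

section Assembly

universe u v

variable {G : Type u} [Group G] {K : Type v} [Field K]

theorem exists_set_of_torsionFreeSocle (K : Type v) [Field K] (G : Type u) [Group G] :
    ∃ X : Set (MonoidAlgebra K G), X ⊆ supported K K (torsionFreeSocle G : Set G) ∧
      Ideal.span X ≠ ⊤ ∧ ∀ N : Subgroup G, IsMinimalNormal N → IsMulCommutative N →
        ¬ IsMulTorsion N → Ideal.span X ⊔ augIdeal K N = ⊤ := by
  let : CommGroup (torsionFreeSocle G) :=
    { (inferInstance : Group (torsionFreeSocle G)) with
      mul_comm := fun a b => Subtype.ext (torsionFreeSocle_comm a.2 b.2) }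
  obtain ⟨J, hJ, h⟩ := exists_ideal_of_torsionFree (K := K) (A := torsionFreeSocle G)
    fun x n hn hx => Subtype.ext
      (eq_one_of_mem_torsionFreeSocle x.2 hn (congrArg Subtype.val hx))
  refine ⟨_, ?_, span_map_subtype_ne_top hJ, fun N hN hc ht => ?_⟩
  · rintro _ ⟨a, -, rfl⟩
    exact mapDomain_subtype_mem_supported a
  · have hle : N ≤ torsionFreeSocle G := le_sSup ⟨hN, hc, ht⟩
    have := span_map_subtype_sup_augIdeal (h (N.subgroupOf (torsionFreeSocle G)) ?_ ?_)
    · rwa [Subgroup.map_subgroupOf_eq_of_le hle] at this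
    · rw [Ne, Subgroup.subgroupOf_eq_bot]
      exact fun h0 => hN.prop.2 (disjoint_self.1 (h0.mono_right hle))
    · rintro x hx n hn
      obtain ⟨y, hy, hyx⟩ := hN.divisible hc ht (Subgroup.mem_subgroupOf.1 hx) hn
      exact ⟨⟨y, hle hy⟩, Subgroup.mem_subgroupOf.2 hy, Subtype.ext hyx⟩

/-- A torsion abelian minimal normal `N` has prime exponent `q`, and `q ≠ char K` by `h3`. The
trivial core of `S` gives `n ∈ N` outside `S`, whose image in the locally cyclic quotient has order
`q`; its geometric sum lies in the pulled-back ideal. -/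
theorem exists_set_of_torsionSocle (h3 : ringChar K ∉ socPrimes G)
    (h4 : ∃ S : Subgroup G, S ≤ torsionSocle G ∧
      IsLocallyCyclic (torsionSocle G ⧸ S.subgroupOf (torsionSocle G)) ∧ S.normalCore = ⊥) :
    ∃ X : Set (MonoidAlgebra K G), X ⊆ supported K K (torsionSocle G : Set G) ∧
      Ideal.span X ≠ ⊤ ∧ ∀ N : Subgroup G, IsMinimalNormal N → IsMulCommutative N →
        IsMulTorsion N → Ideal.span X ⊔ augIdeal K N = ⊤ := by
  obtain ⟨S, -, hcyc, hcore⟩ := h4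
  let : CommGroup (torsionSocle G ⧸ S.subgroupOf (torsionSocle G)) :=
    { (inferInstance : Group (torsionSocle G ⧸ S.subgroupOf (torsionSocle G))) with
      mul_comm := fun a b => by
        induction a using QuotientGroup.induction_on with | H a =>
        induction b using QuotientGroup.induction_on with | H b =>
        exact congrArg QuotientGroup.mk (Subtype.ext (torsionSocle_comm a.2 b.2)) }
  let π := QuotientGroup.mk' (S.subgroupOf (torsionSocle G))
  obtain ⟨J, hJ, h⟩ := exists_ideal_of_isLocallyCyclic (K := K) hcyc
  have hJ' : J.comap (mapDomainRingHom K π) ≠ ⊤ := Ideal.comap_ne_top _ hJ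
  refine ⟨_, ?_, span_map_subtype_ne_top hJ', fun N hN hc ht => ?_⟩
  · rintro _ ⟨a, -, rfl⟩
    exact mapDomain_subtype_mem_supported a
  have hle : N ≤ torsionSocle G := le_sSup ⟨hN, hc, ht⟩
  obtain ⟨q, hq, hNq⟩ := hN.exists_prime_pow_eq_one hc ht
  have hqK : (q : K) ≠ 0 := by
    intro h0
    have hdvd := ringChar.dvd h0
    have hchar : ringChar K = q :=
      ((Nat.dvd_prime hq).1 hdvd).resolve_left CharP.ringChar_ne_one
    refine h3 ⟨hchar ▸ hq, fun hbot => hN.prop.2 ((Subgroup.eq_bot_iff_forall _).2 fun x hx => ?_)⟩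
    refine (Subgroup.eq_bot_iff_forall _).1 hbot x ⟨hle hx, 1, ?_⟩
    rw [hchar, pow_one]
    exact hNq x hx
  obtain ⟨n, hn, hnS⟩ : ∃ n ∈ N, n ∉ S := by
    by_contra! hNS
    have hNn := hN.prop.1
    exact hN.prop.2 (le_bot_iff.1 (hcore ▸ Subgroup.normal_le_normalCore.2 hNS))
  have hsup := sup_augIdeal_eq_top_of_geomSum_mem (K := K) (I := J.comap (mapDomainRingHom K π))
    (N := N.subgroupOf (torsionSocle G)) (q := q) hqK (x := ⟨n, hle hn⟩)
    (Subgroup.mem_subgroupOf.2 hn) ?_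
  · have := span_map_subtype_sup_augIdeal hsup
    rwa [Subgroup.map_subgroupOf_eq_of_le hle] at this
  · rw [Ideal.mem_comap, map_geomSum]
    refine h q hq _ ?_ ?_
    · rw [Ne, QuotientGroup.mk'_apply, QuotientGroup.eq_one_iff, Subgroup.mem_subgroupOf]
      exact hnS
    · rw [← map_pow]
      have : (⟨n, hle hn⟩ : torsionSocle G) ^ q = 1 := Subtype.ext (hNq n hn)
      rw [this, map_one]

theorem exists_set_of_not_isMulCommutative {N : Subgroup G} (hN : IsMinimalNormal N)
    (hnc : ¬ IsMulCommutative N)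
    (h2 : ∀ p : ℕ, p.Prime → CharP K p → IsPGroup p N → ¬ Group.FG N →
      HasNontrivialIrreducibleRep K N) :
    ∃ X : Set (MonoidAlgebra K G), X ⊆ supported K K (N : Set G) ∧
      Ideal.span X ≠ ⊤ ∧ Ideal.span X ⊔ augIdeal K N = ⊤ := by
  obtain ⟨J, hJ, hJN⟩ : ∃ J : Ideal (MonoidAlgebra K N), J ≠ ⊤ ∧ J ⊔ augIdeal K ⊤ = ⊤ := by
    have hnt : Nontrivial N := (Subgroup.nontrivial_iff_ne_bot N).2 hN.prop.2
    -- Elements of infinite order fall under the first case, as every prime divides `0`. In the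
    -- second case every element has finite order divisible by no prime other than `char K`.
    by_cases hex : ∃ (x : N) (q : ℕ), q.Prime ∧ (q : K) ≠ 0 ∧ q ∣ orderOf x
    · obtain ⟨x, q, hq, hqK, hqx⟩ := hex
      exact exists_ideal_of_dvd_orderOf hq hqK hqx
    · push Not at hex
      obtain ⟨r, hr, hrK⟩ := exists_prime_natCast_ne_zero K
      have hord : ∀ x : N, orderOf x ≠ 0 := fun x h0 => hex x r hr hrK (h0 ▸ dvd_zero r)
      obtain ⟨x, hx⟩ := exists_ne (1 : N)
      obtain ⟨p, hp, hpx⟩ := Nat.exists_prime_and_dvd (n := orderOf x)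
        fun h => hx (orderOf_eq_one_iff.1 h)
      have hpK : (p : K) = 0 := by
        by_contra h
        exact hex x p hp h hpx
      have hchar : CharP K p := by
        have : ringChar K = p := ((Nat.dvd_prime hp).1 (ringChar.dvd hpK)).resolve_left
          CharP.ringChar_ne_one
        exact this ▸ ringChar.charP K
      have hpg : IsPGroup p N := by
        intro y
        have : orderOf y = p ^ (orderOf y).primeFactorsList.length := by
          refine Nat.eq_prime_pow_of_unique_prime_dvd (hord y) fun {d} hd hdy => ?_
          by_contra hne
          refine hex y d hd (fun h0 => hne ?_) hdy
          exact ((Nat.prime_dvd_prime_iff_eq hp hd).1 ((CharP.cast_eq_zero_iff K p d).1 h0)).symm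
        exact ⟨_, by rw [← this, pow_orderOf_eq_one]⟩
      by_cases hfg : Group.FG N
      · exact exists_ideal_of_fg_of_perfect (hN.commutator_eq_top hnc)
      · exact exists_ideal_of_hasNontrivialIrreducibleRep (h2 p hp hchar hpg hfg)
  refine ⟨_, ?_, span_map_subtype_ne_top hJ, ?_⟩
  · rintro _ ⟨a, -, rfl⟩
    exact mapDomain_subtype_mem_supported a
  · have := span_map_subtype_sup_augIdeal hJN
    rwa [← MonoidHom.range_eq_map, Subgroup.range_subtype] at this

theorem isIrreducible_ofModule' {M : Type*} [AddCommGroup M] [Module K M]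
    [Module (MonoidAlgebra K G) M] [IsScalarTower K (MonoidAlgebra K G) M]
    [IsSimpleModule (MonoidAlgebra K G) M] :
    (Representation.ofModule' (k := K) (G := G) M).IsIrreducible := by
  rw [Representation.irreducible_iff_isSimpleModule_asModule]
  let ρ := Representation.ofModule' (k := K) (G := G) M
  have hρ : ∀ (r : MonoidAlgebra K G) (x : M), ρ.asAlgebraHom r x = r • x := by
    intro r x
    have : ρ.asAlgebraHom = Algebra.lsmul K K M :=
      (MonoidAlgebra.lift K (Module.End K M) G).apply_symm_apply _
    rw [this]
    rfl
  let e : ρ.asModule ≃ₗ[MonoidAlgebra K G] M :=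
    { ρ.asModuleEquiv.toAddEquiv with
      map_smul' := fun r x => (ρ.asModuleEquiv_map_smul r x).trans (hρ r _) }
  exact IsSimpleModule.congr e

/-- If no minimal normal subgroup acts trivially on a simple module over the group algebra, then the
module gives a faithful irreducible representation. -/
theorem hasFaithfulIrreducibleRep_of_isSimpleModule (h1 : IsEssential (socle G))
    {M : Type (max u v)} [AddCommGroup M] [Module K M] [Module (MonoidAlgebra K G) M]
    [IsScalarTower K (MonoidAlgebra K G) M] [IsSimpleModule (MonoidAlgebra K G) M]
    (h : ∀ N : Subgroup G, IsMinimalNormal N → ∃ n ∈ N, ∃ m : M, of K G n • m ≠ m) :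
    HasFaithfulIrreducibleRep K G := by
  let ρ := Representation.ofModule' (k := K) (G := G) M
  refine ⟨M, inferInstance, inferInstance, ρ, isIrreducible_ofModule', ?_⟩
  rw [← MonoidHom.ker_eq_bot_iff]
  by_contra hker
  obtain ⟨N, hN, hle⟩ := exists_isMinimalNormal_le (S := {N | IsMinimalNormal N})
    (fun _ h => h) (MonoidHom.normal_ker ρ) (h1.2 _ (MonoidHom.normal_ker ρ) hker)
  obtain ⟨n, hn, m, hm⟩ := h N hN
  have hn1 : ρ n = 1 := hle hn
  exact hm (LinearMap.congr_fun hn1 m)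

/-- In the quotient by a maximal left ideal `I ≥ J`, trivial action of `N` on the class of `1` alone
already puts every `n - 1` in `I`. -/
theorem hasFaithfulIrreducibleRep_of_ideal (h1 : IsEssential (socle G))
    {J : Ideal (MonoidAlgebra K G)} (hJ : J ≠ ⊤)
    (hJN : ∀ N : Subgroup G, IsMinimalNormal N → J ⊔ augIdeal K N = ⊤) :
    HasFaithfulIrreducibleRep K G := by
  obtain ⟨I, hI, hJI⟩ := Ideal.exists_le_maximal J hJ
  have hsimple : IsSimpleModule (MonoidAlgebra K G) (MonoidAlgebra K G ⧸ I) :=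
    isSimpleModule_iff_isCoatom.2 hI.out
  refine hasFaithfulIrreducibleRep_of_isSimpleModule (K := K)
    (M := MonoidAlgebra K G ⧸ I) h1 fun N hN => ?_
  by_contra! h
  refine hI.ne_top (top_le_iff.1 ((hJN N hN).ge.trans (sup_le hJI (Ideal.span_le.2 ?_))))
  rintro _ ⟨n, hn, rfl⟩
  have h4 := h n hn (Submodule.Quotient.mk 1)
  rwa [← Submodule.Quotient.mk_smul, Submodule.Quotient.eq, smul_eq_mul, mul_one] at h4

end Assembly

end FaithfulIrr

theorem theorem1 {G : Type*} [Group G] {K : Type*} [Field K]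
    (h1 : FaithfulIrr.IsEssential (FaithfulIrr.socle G))
    (h2 : ∀ p : ℕ, p.Prime → CharP K p → ∀ M : Subgroup G, FaithfulIrr.IsMinimalNormal M →
      IsPGroup p M → ¬ IsMulCommutative M → ¬ Group.FG M →
      FaithfulIrr.HasNontrivialIrreducibleRep K M)
    (h3 : ringChar K ∉ FaithfulIrr.socPrimes G)
    (h4 : ∃ S : Subgroup G, S ≤ FaithfulIrr.torsionSocle G ∧
      FaithfulIrr.IsLocallyCyclic
        (FaithfulIrr.torsionSocle G ⧸ S.subgroupOf (FaithfulIrr.torsionSocle G)) ∧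
      S.normalCore = ⊥) :
    FaithfulIrr.HasFaithfulIrreducibleRep K G := by
  open FaithfulIrr MonoidAlgebra in
  obtain ⟨X, hXs, hX, hXN⟩ := exists_set_of_torsionFreeSocle K G
  obtain ⟨Y, hYs, hY, hYN⟩ := exists_set_of_torsionSocle h3 h4
  have hZ := fun N : {N : Subgroup G // IsMinimalNormal N ∧ ¬ IsMulCommutative N} =>
    exists_set_of_not_isMulCommutative (K := K) N.2.1 N.2.2
      fun p hp hc hpg hfg => h2 p hp hc N N.2.1 hpg N.2.2 hfg
  choose Z hZs hZ hZN using hZ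
  have hA : (torsionFreeSocle G).Normal := normal_torsionFreeSocle
  have hT : (torsionSocle G).Normal := normal_torsionSocle
  have hXY : Ideal.span (X ∪ Y) ≠ ⊤ := span_union_ne_top
    (fun c hc d hd => Subgroup.commute_of_normal_of_disjoint _ _ hA hT
      disjoint_torsionFreeSocle_torsionSocle c d hc hd)
    disjoint_torsionFreeSocle_torsionSocle hXs hYs hX hY
  have hcomm : ∀ i : {N : Subgroup G // IsMinimalNormal N ∧ ¬ IsMulCommutative N},
      ∀ s : Finset {N : Subgroup G // IsMinimalNormal N ∧ ¬ IsMulCommutative N}, i ∉ s →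
      ∀ c ∈ (torsionFreeSocle G ⊔ torsionSocle G) ⊔ ⨆ j ∈ s, (j : Subgroup G),
      ∀ d ∈ (i : Subgroup G), c * d = d * c := by
    intro i s his c hc d hd
    have hle : (torsionFreeSocle G ⊔ torsionSocle G) ⊔ ⨆ j ∈ s, (j : Subgroup G) ≤
        Subgroup.centralizer {d} := by
      refine sup_le (sup_le (sSup_le ?_) (sSup_le ?_)) (iSup₂_le ?_)
      · intro N hN a ha
        exact Subgroup.mem_centralizer_singleton_iff.2 (hN.1.commute i.2.1 hN.2.1 ha hd)
      · intro N hN a ha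
        exact Subgroup.mem_centralizer_singleton_iff.2 (hN.1.commute i.2.1 hN.2.1 ha hd)
      · intro N hN a ha
        exact Subgroup.mem_centralizer_singleton_iff.2 (N.2.1.commute_of_ne i.2.1
          (fun h => his (by rwa [← Subtype.ext h])) ha hd)
    exact Subgroup.mem_centralizer_singleton_iff.1 (hle hc)
  refine hasFaithfulIrreducibleRep_of_ideal h1
    (J := Ideal.span ((X ∪ Y) ∪ ⋃ i, Z i)) ?_ ?_
  · refine span_union_iUnion_ne_top hcomm (fun i s his => ?_) ?_ hZs hXY hZ
    -- A normal subgroup commuting with a non-abelian minimal normal subgroup cannot contain it,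
    -- hence meets it trivially; so commutation already yields independence.
    · refine i.2.1.disjoint_of_commute i.2.2 ?_ (hcomm i s his)
      have hn : ∀ j : {N : Subgroup G // IsMinimalNormal N ∧ ¬ IsMulCommutative N},
          (j : Subgroup G).Normal := fun j => j.2.1.prop.1
      infer_instance
    · exact Set.union_subset
        (hXs.trans (supported_mono (SetLike.coe_subset_coe.2 le_sup_left)))
        (hYs.trans (supported_mono (SetLike.coe_subset_coe.2 le_sup_right)))
  · intro N hN
    rw [eq_top_iff]
    by_cases hc : IsMulCommutative N
    · by_cases ht : IsMulTorsion N
      · exact (hYN N hN hc ht).ge.trans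
          (sup_le_sup_right (Ideal.span_mono fun a ha => Or.inl (Or.inr ha)) _)
      · exact (hXN N hN hc ht).ge.trans
          (sup_le_sup_right (Ideal.span_mono fun a ha => Or.inl (Or.inl ha)) _)
    · have hle : Ideal.span (Z ⟨N, hN, hc⟩) ≤ Ideal.span ((X ∪ Y) ∪ ⋃ i, Z i) :=
        Ideal.span_mono ((Set.subset_iUnion Z _).trans Set.subset_union_right)
      exact (hZN ⟨N, hN, hc⟩).ge.trans (sup_le_sup_right hle _)
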